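/- Let $\theta_1,\theta_2,\dots$ be real random variables with distribution function $F$; for each $T\in\mathbb N$ let $\varepsilon_{1,T},\varepsilon_{2,T},\dots$ be real random variables with distribution function $G_T$, such that for each $T$ the vectors $(\theta_i,\varepsilon_{i,T})$, $i\ge 1$, are independent and identically distributed (the dependence between $\theta_i$ and $\varepsilon_{i,T}$ is unrestricted). For a fixed $p>0$ put $\vartheta_{i,T}=\theta_i+T^{-p}\varepsilon_{i,T}$, and let $\vartheta_{1,N,T}\le\dots\le\vartheta_{N,N,T}$ and $\theta_{1,N}\le\dots\le\theta_{N,N}$ be the order statistics of $\vartheta_{1,T},\dots,\vartheta_{N,T}$ and of $\theta_1,\dots,\theta_N$. Quantile functions are $F^{-1}(u)=\inf\{x\in\mathbb R:F(x)\ge u\}\in[-\infty,\infty]$. Assume that $F$ is in the weak domain of attraction of an extreme value distribution with index $\gamma\in\mathbb R$, that $a_N>0$ and $b_N$ are constants such that $(\theta_{N,N}-b_N)/a_N$ converges in law to a nondegenerate random variable as $N\to\infty$, and that the following tail equivalence conditions hold as $N,T\to\infty$ (jointly, along the path, or more generally the countably generated mode of divergence, that is considered): for each $\tau\in(0,\infty)$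 there is $\epsilon\in(0,1)$ with $$\sup_{u\in[0,\epsilon]}\frac1{a_N}\Big(F^{-1}\big(1-\tfrac1{N\tau}-u\big)-F^{-1}\big(1-\tfrac1{N\tau}\big)+\tfrac1{T^p}G_T^{-1}(u)\Big)\to0,$$ and for each $\tau\in(0,\infty)$ $$\inf_{u\in[0,\frac1{N\tau}]}\frac1{a_N}\Big(F^{-1}\big(1-\tfrac1{N\tau}+u\big)-F^{-1}\big(1-\tfrac1{N\tau}\big)+\tfrac1{T^p}G_T^{-1}(1-u)\Big)\to0.$$ Let $q\ge1$ and $r\ge0$ be fixed integers, $l>0$ a fixed real number, $E_1^*,E_2^*,\dots$ iid standard exponential random variables, and $S_k=E_1^*+\dots+E_k^*$. Then, as $N,T\to\infty$ in the same way, $$\frac{\vartheta_{N-r,N,T}-F^{-1}(1-l/N)}{\vartheta_{N-q,N,T}-\vartheta_{N,N,T}}\;\Rightarrow\;\frac{S_{r+1}^{-\gamma}-l^{-\gamma}}{S_{q+1}^{-\gamma}-S_1^{-\gamma}},$$ where for $\gamma=0$ the right-hand side means $[\log S_{r+1}-\log l]/[\log S_{q+1}-\log S_1]$. If in addition $\gamma<0$,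 then $F^{-1}(1)<\infty$ and the same convergence holds with $l=0$, that is, $$\frac{\vartheta_{N-r,N,T}-F^{-1}(1)}{\vartheta_{N-q,N,T}-\vartheta_{N,N,T}}\;\Rightarrow\;\frac{S_{r+1}^{-\gamma}}{S_{q+1}^{-\gamma}-S_1^{-\gamma}}.$$ -/

import Mathlib

open Filter Topology MeasureTheory ProbabilityTheory

noncomputable section

/-- The `k`-th smallest (`1 ≤ k ≤ N`) of the `N` sample values `x 0, …, x (N - 1)`;
so `k = N` gives the maximum. Outside `1 ≤ k ≤ N` the value is the placeholder `0`. -/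
def orderStat (x : ℕ → ℝ) (k N : ℕ) : ℝ :=
  if h : 1 ≤ k ∧ k ≤ N then
    ((fun i : Fin N => x i) ∘ Tuple.sort (fun i : Fin N => x i)) ⟨k - 1, by omega⟩
  else 0

/-- The quantile function `F⁻¹(u) = inf {x ∈ ℝ : F(x) ≥ u}` (left-continuous inverse), with values
in the extended reals: `F⁻¹(0) = -∞`, and `F⁻¹(1)` is the right endpoint of the support, which
may be `+∞`. -/
def quantile (F : ℝ → ℝ) (u : ℝ) : EReal :=
  ⨅ (x : ℝ) (_ : u ≤ F x), (x : EReal)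

/-- The cdf of the extreme value distribution with index `γ`: `exp (-(1 + γ x) ^ (-1/γ))` where
`1 + γ x > 0`, and `exp (-exp (-x))` for `γ = 0`. -/
def gevCDF (γ x : ℝ) : ℝ :=
  if γ = 0 then Real.exp (-Real.exp (-x))
  else if 0 < 1 + γ * x then Real.exp (-(1 + γ * x) ^ (-1 / γ))
  else if 0 < γ then 0 else 1

/-- The cdf `F` is in the (weak) domain of attraction of the extreme value distribution with
index `γ`: for some `α_N > 0` and `β_N`, the cdf `F(α_N x + β_N) ^ N` of the normalised maximum of
`N` independent draws from `F` converges weakly to the extreme value cdf (which is continuous). -/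
def InDomainOfAttraction (F : ℝ → ℝ) (γ : ℝ) : Prop :=
  ∃ α β : ℕ → ℝ, (∀ N, 0 < α N) ∧
    ∀ x : ℝ, Tendsto (fun N : ℕ => F (α N * x + β N) ^ N) atTop (𝓝 (gevCDF γ x))

/-- The noisy observation `ϑ_{i,T} = θ_i + T^{-p} ε_{i,T}`. -/
def noisyObs {Ω : Type*} (p : ℝ) (θ : ℕ → Ω → ℝ) (ε : ℕ → ℕ → Ω → ℝ) (T i : ℕ) (ω : Ω) : ℝ :=
  θ i ω + 1 / (T : ℝ) ^ p * ε i T ω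

/-- The tail equivalence condition for the supremum, as `(N, T) → ∞` along the filter `l`. -/
def TailEquivSup (F : ℝ → ℝ) (G : ℕ → ℝ → ℝ) (p : ℝ) (a : ℕ → ℝ) (l : Filter (ℕ × ℕ)) : Prop :=
  ∀ τ : ℝ, 0 < τ → ∃ ε ∈ Set.Ioo (0 : ℝ) 1,
    Tendsto (fun s : ℕ × ℕ => ⨆ u ∈ Set.Icc (0 : ℝ) ε,
      ((1 / a s.1 : ℝ) : EReal) *
        (quantile F (1 - 1 / (s.1 * τ) - u) - quantile F (1 - 1 / (s.1 * τ))
          + ((1 / (s.2 : ℝ) ^ p : ℝ) : EReal) * quantile (G s.2) u)) l (𝓝 0)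

/-- The tail equivalence condition for the infimum, as `(N, T) → ∞` along the filter `l`. -/
def TailEquivInf (F : ℝ → ℝ) (G : ℕ → ℝ → ℝ) (p : ℝ) (a : ℕ → ℝ) (l : Filter (ℕ × ℕ)) : Prop :=
  ∀ τ : ℝ, 0 < τ →
    Tendsto (fun s : ℕ × ℕ => ⨅ u ∈ Set.Icc (0 : ℝ) (1 / (s.1 * τ)),
      ((1 / a s.1 : ℝ) : EReal) *
        (quantile F (1 - 1 / (s.1 * τ) + u) - quantile F (1 - 1 / (s.1 * τ))
          + ((1 / (s.2 : ℝ) ^ p : ℝ) : EReal) * quantile (G s.2) (1 - u))) l (𝓝 0)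

/-- The self-normalised statistic
`(ϑ_{N-r,N,T} - F⁻¹(1 - c/N)) / (ϑ_{N-q,N,T} - ϑ_{N,N,T})` for a sample `x` of noisy
observations. -/
def evtRatio (F : ℝ → ℝ) (x : ℕ → ℝ) (N q r : ℕ) (c : ℝ) : ℝ :=
  (orderStat x (N - r) N - (quantile F (1 - c / N)).toReal) /
    (orderStat x (N - q) N - orderStat x N N)

/-- The limit variable as a function of `e = (E₁, E₂, …)` (indexed from `0`), with
`S_k = E₁ + … + E_k`: it is `(S_{r+1}^{-γ} - c^{-γ}) / (S_{q+1}^{-γ} - S_1^{-γ})` for `γ ≠ 0`, and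
`(log S_{r+1} - log c) / (log S_{q+1} - log S_1)` for `γ = 0`. -/
def evtLimit (γ : ℝ) (e : ℕ → ℝ) (q r : ℕ) (c : ℝ) : ℝ :=
  if γ = 0 then
    (Real.log (∑ i ∈ Finset.range (r + 1), e i) - Real.log c) /
      (Real.log (∑ i ∈ Finset.range (q + 1), e i) - Real.log (e 0))
  else
    ((∑ i ∈ Finset.range (r + 1), e i) ^ (-γ) - c ^ (-γ)) /
      ((∑ i ∈ Finset.range (q + 1), e i) ^ (-γ) - (e 0) ^ (-γ))

end

/-! ### Quantile functions of probability measures -/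

section Quantile

variable {μ : Measure ℝ}

/-! For fixed `T` the noisy sample has the law of `Q_T(exp(-V_i))`, with `Q_T` the quantile function
of one observation and `V_i` iid standard exponentials. This transform is decreasing, so the largest
observations come from the smallest `V_i`. By Rényi (`map_comp_sort_pi_expMeasure`) the ordered
`V_i` are jointly distributed as the sums `∑_{i ≤ j} E_i / (N - i)`, and `N` times such a sum tends
to `S_{j+1}` pointwise. Hence the statistic has, for each `(N, T)`, the law of a copy built from the
`E_i` (`map_evtRatio_eq`), and almost sure convergence of the copies suffices.

That convergence concerns quantiles only. Attraction gives `(F⁻¹(1 - t/N) - β_N)/α_N → gevQuantile γ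
t` (`tendsto_quantileReal_div`). The tail conditions, combined with bounds on the quantiles of a sum
valid under any dependence, carry this limit over to `Q_T` at the levels `1 - t/N`; monotonicity
then handles the random levels `exp(-w_N)` with `N w_N → S_{j+1}` (`tendsto_expQuantile_noisy`).
Their errors are of size `o(a_N)`, which is harmless since `a = O(α)` (`exists_eventually_le_mul`).
In the ratio `α` and `β` cancel.

For `γ < 0` and `l = 0` the centring is the right endpoint. The increments of `F⁻¹(1 - 1/M)` under
doubling of `M` shrink geometrically with ratio about `2^γ < 1`, so the endpoint is finite and has
the normalised limit `-1/γ`. -/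

lemma quantile_le_coe_iff {u x : ℝ} : quantile (cdf μ) u ≤ (x : EReal) ↔ u ≤ cdf μ x := by
  constructor
  · intro h
    -- Right continuity of the cdf makes the infimum attained.
    have hright : ContinuousWithinAt (cdf μ) (Set.Ioi x) x :=
      ((cdf μ).right_continuous x).mono Set.Ioi_subset_Ici_self
    refine ge_of_tendsto hright.tendsto ?_
    filter_upwards [self_mem_nhdsWithin] with y hy
    have hlt : quantile (cdf μ) u < (y : EReal) := h.trans_lt (EReal.coe_lt_coe_iff.2 hy)
    simp only [quantile, iInf_lt_iff] at hlt
    obtain ⟨z, hz, hzy⟩ := hlt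
    exact hz.trans (monotone_cdf μ (EReal.coe_lt_coe_iff.1 hzy).le)
  · intro h
    exact iInf₂_le x h

lemma quantile_mono (F : ℝ → ℝ) : Monotone (quantile F) := fun _ _ huv =>
  le_iInf₂ fun x hx => iInf₂_le (f := fun (x : ℝ) (_ : _ ≤ F x) => (x : EReal)) x (huv.trans hx)

lemma quantile_ne_top {u : ℝ} (hu : u < 1) : quantile (cdf μ) u ≠ ⊤ := by
  obtain ⟨x, hx⟩ := ((tendsto_cdf_atTop μ).eventually (lt_mem_nhds hu)).exists
  exact ((quantile_le_coe_iff.2 hx.le).trans_lt (EReal.coe_lt_top x)).ne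

lemma quantile_ne_bot {u : ℝ} (hu : 0 < u) : quantile (cdf μ) u ≠ ⊥ := by
  obtain ⟨x, hx⟩ := ((tendsto_cdf_atBot μ).eventually (gt_mem_nhds hu)).exists
  intro h
  exact hx.not_ge (quantile_le_coe_iff.1 (h ▸ bot_le))

lemma quantile_eq_bot {u : ℝ} (hu : u ≤ 0) : quantile (cdf μ) u = ⊥ := by
  rw [EReal.eq_bot_iff_forall_lt]
  intro y
  have : quantile (cdf μ) u ≤ ((y - 1 : ℝ) : EReal) :=
    quantile_le_coe_iff.2 (hu.trans (cdf_nonneg μ _))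
  exact this.trans_lt (EReal.coe_lt_coe_iff.2 (by linarith))

/-- The real-valued quantile function of a probability measure on the line. -/
noncomputable def quantileReal (μ : Measure ℝ) (u : ℝ) : ℝ := (quantile (cdf μ) u).toReal

lemma coe_quantileReal {u : ℝ} (h0 : 0 < u) (h1 : u < 1) :
    (quantileReal μ u : EReal) = quantile (cdf μ) u :=
  EReal.coe_toReal (quantile_ne_top h1) (quantile_ne_bot h0)

lemma quantileReal_le_iff {u x : ℝ} (h0 : 0 < u) (h1 : u < 1) :
    quantileReal μ u ≤ x ↔ u ≤ cdf μ x := by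
  rw [← quantile_le_coe_iff, ← coe_quantileReal h0 h1, EReal.coe_le_coe_iff]

lemma lt_quantileReal_iff {u x : ℝ} (h0 : 0 < u) (h1 : u < 1) :
    x < quantileReal μ u ↔ cdf μ x < u := by
  rw [← not_le, quantileReal_le_iff h0 h1, not_le]

lemma quantileReal_mono {u v : ℝ} (h0 : 0 < u) (huv : u ≤ v) (h1 : v < 1) :
    quantileReal μ u ≤ quantileReal μ v := by
  rw [quantileReal_le_iff h0 (huv.trans_lt h1)]
  exact huv.trans ((quantileReal_le_iff (h0.trans_le huv) h1).1 le_rfl)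

end Quantile

/-! ### Sums of random variables with unrestricted dependence -/

section Sum

variable {Ω : Type*} [MeasurableSpace Ω] {P : Measure Ω} [IsProbabilityMeasure P]

lemma cdf_map_eq_measureReal {X : Ω → ℝ} (hX : Measurable X) (x : ℝ) :
    cdf (P.map X) x = P.real {ω | X ω ≤ x} := by
  have := Measure.isProbabilityMeasure_map (μ := P) hX.aemeasurable
  rw [cdf_eq_real, map_measureReal_apply hX measurableSet_Iic]
  rfl

/-- A union bound, so the joint law is irrelevant: if the sum stays below `x + c * y` by `2d`, then
`X ≤ x - d` or `Y ≤ y - d / c`. It amounts to the quantile bound `Q_{X+cY}(w+u) ≥ Q_X(w) + c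
Q_Y(u)`. -/
lemma cdf_add_mul_lt {X Y : Ω → ℝ} (hX : Measurable X) (hY : Measurable Y) {c x y w u : ℝ}
    (hc : 0 < c) (hx : ∀ x' < x, cdf (P.map X) x' < w) (hy : ∀ y' < y, cdf (P.map Y) y' < u)
    {z : ℝ} (hz : z < x + c * y) :
    cdf (P.map fun ω => X ω + c * Y ω) z < w + u := by
  set d := (x + c * y - z) / 2 with hd
  have hd0 : 0 < d := by rw [hd]; linarith
  have h1 := hx (x - d) (by linarith)
  have h2 := hy (y - d / c) (by have := div_pos hd0 hc; linarith)
  rw [cdf_map_eq_measureReal hX] at h1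
  rw [cdf_map_eq_measureReal hY] at h2
  rw [cdf_map_eq_measureReal (X := fun ω => X ω + c * Y ω) (hX.add (hY.const_mul c))]
  refine lt_of_le_of_lt ?_ (add_lt_add h1 h2)
  refine (measureReal_mono ?_).trans (measureReal_union_le _ _)
  intro ω hω
  simp only [Set.mem_ofPred_eq, Set.mem_union] at hω ⊢
  by_contra! hcon
  have h3 : c * (y - d / c) < c * Y ω := mul_lt_mul_of_pos_left hcon.2 hc
  have h4 : c * (y - d / c) = c * y - d := by field_simp
  linarith [hcon.1]

/-- The opposite bound for unrestricted dependence, from `P(A ∩ B) ≥ P(A) + P(B) - 1`. -/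
lemma le_cdf_add_mul {X Y : Ω → ℝ} (hX : Measurable X) (hY : Measurable Y) {c x y : ℝ}
    (hc : 0 < c) :
    cdf (P.map X) x + cdf (P.map Y) y - 1 ≤
      cdf (P.map fun ω => X ω + c * Y ω) (x + c * y) := by
  rw [cdf_map_eq_measureReal hX, cdf_map_eq_measureReal hY,
    cdf_map_eq_measureReal (X := fun ω => X ω + c * Y ω) (hX.add (hY.const_mul c))]
  have h1 := measureReal_union_add_inter (μ := P) (s := {ω | X ω ≤ x})
    (measurableSet_le hY (measurable_const (a := y)))
  have h2 : P.real ({ω | X ω ≤ x} ∪ {ω | Y ω ≤ y}) ≤ 1 := measureReal_le_one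
  have h3 : P.real ({ω | X ω ≤ x} ∩ {ω | Y ω ≤ y}) ≤ P.real {ω | X ω + c * Y ω ≤ x + c * y} := by
    refine measureReal_mono ?_
    rintro ω ⟨h4, h5⟩
    exact add_le_add h4 (mul_le_mul_of_nonneg_left h5 hc.le)
  linarith

variable {θ₀ : Ω → ℝ} {ε₀ : ℕ → Ω → ℝ} {p : ℝ} {a : ℕ → ℝ} {l : Filter (ℕ × ℕ)}

lemma eventually_large (hl : l ≤ atTop ×ˢ atTop) {τ : ℝ} (hτ : 0 < τ) {d : ℝ} (hd : 0 < d) :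
    ∀ᶠ s in l, 0 < 1 / ((s.1 : ℝ) * τ) ∧ 1 / ((s.1 : ℝ) * τ) < d ∧ 0 < 1 / (s.2 : ℝ) ^ p := by
  have h1 : Tendsto (fun s : ℕ × ℕ => (s.1 : ℝ) * τ) l atTop :=
    (tendsto_natCast_atTop_atTop.comp (tendsto_fst.mono_left hl)).atTop_mul_const hτ
  have h2 : Tendsto (fun s : ℕ × ℕ => s.2) l atTop := tendsto_snd.mono_left hl
  filter_upwards [h1.eventually_gt_atTop 0, h1.eventually_gt_atTop (1 / d),
    h2.eventually_gt_atTop 0] with s hs1 hs2 hs3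
  refine ⟨by positivity, ?_, by positivity⟩
  rw [div_lt_iff₀ hs1]
  rwa [div_lt_iff₀ hd, mul_comm] at hs2

/-- Only the lower half of the limit matters: a supremum above `-δ` supplies one `u` at which the
bracket exceeds `-δ`, and `cdf_add_mul_lt` is applied with the level `v` split as `(v - u) + u`. -/
lemma TailEquivSup.eventually_quantileReal_sub_le (hθ : Measurable θ₀) (hε : ∀ T, Measurable (ε₀ T))
    (ha : ∀ N, 0 < a N) (hl : l ≤ atTop ×ˢ atTop)
    (h : TailEquivSup (cdf (P.map θ₀)) (fun T => cdf (P.map (ε₀ T))) p a l)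
    {τ δ : ℝ} (hτ : 0 < τ) (hδ : 0 < δ) :
    ∀ᶠ s in l, quantileReal (P.map θ₀) (1 - 1 / (s.1 * τ)) - δ * a s.1 ≤
      quantileReal (P.map fun ω => θ₀ ω + 1 / (s.2 : ℝ) ^ p * ε₀ s.2 ω) (1 - 1 / (s.1 * τ)) := by
  obtain ⟨e, he, htend⟩ := h τ hτ
  have hδ' : ((-δ : ℝ) : EReal) < 0 := by exact_mod_cast neg_lt_zero.2 hδ
  filter_upwards [htend.eventually (lt_mem_nhds hδ'), eventually_large (p := p) hl hτ one_pos]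
    with s hs ⟨hv0, hv1, hc⟩
  have := Measure.isProbabilityMeasure_map (μ := P) hθ.aemeasurable
  have := Measure.isProbabilityMeasure_map (μ := P) (hε s.2).aemeasurable
  have hsum : Measurable fun ω => θ₀ ω + 1 / (s.2 : ℝ) ^ p * ε₀ s.2 ω :=
    hθ.add ((hε s.2).const_mul _)
  have := Measure.isProbabilityMeasure_map (μ := P) hsum.aemeasurable
  set v := 1 - 1 / ((s.1 : ℝ) * τ) with hv
  have hv0' : 0 < v := by linarith
  have hv1' : v < 1 := by linarith
  simp only [lt_iSup_iff] at hs
  obtain ⟨u, hu, hs⟩ := hs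
  have hinv : 0 < 1 / a s.1 := by have := ha s.1; positivity
  have hu1 : u < 1 := hu.2.trans_lt he.2
  -- At `u = 0`, and likewise at `u ≥ v`, one of the quantiles is `-∞` and drags the bracket to
  -- `-∞`, so such `u` cannot be the witness.
  rcases hu.1.eq_or_lt with hu0 | hu0
  · rw [← hu0, quantile_eq_bot le_rfl, EReal.coe_mul_bot_of_pos hc, EReal.add_bot,
      EReal.coe_mul_bot_of_pos hinv] at hs
    simp at hs
  rcases le_or_gt (v - u) 0 with hvu | hvu
  · rw [quantile_eq_bot hvu, EReal.bot_sub, EReal.bot_add, EReal.coe_mul_bot_of_pos hinv] at hs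
    simp at hs
  have hvu1 : v - u < 1 := by linarith
  rw [← coe_quantileReal hvu hvu1, ← coe_quantileReal hv0' hv1', ← coe_quantileReal hu0 hu1] at hs
  norm_cast at hs
  by_contra! hcon
  have hlt : quantileReal (P.map fun ω => θ₀ ω + 1 / (s.2 : ℝ) ^ p * ε₀ s.2 ω) v <
      quantileReal (P.map θ₀) (v - u) + 1 / (s.2 : ℝ) ^ p * quantileReal (P.map (ε₀ s.2)) u := by
    rw [one_div_mul_eq_div, lt_div_iff₀ (ha s.1)] at hs
    linarith
  have h1 := cdf_add_mul_lt (P := P) hθ (hε s.2) hc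
    (fun x' hx' => (lt_quantileReal_iff hvu hvu1).1 hx')
    (fun y' hy' => (lt_quantileReal_iff hu0 hu1).1 hy') hlt
  rw [sub_add_cancel, ← lt_quantileReal_iff hv0' hv1'] at h1
  exact h1.false

/-- An infimum below `δ` supplies one `u`, and `le_cdf_add_mul` is applied at the levels `v + u` and
`1 - u`, whose sum exceeds `1` by `v`. -/
lemma TailEquivInf.eventually_quantileReal_le_add (hθ : Measurable θ₀) (hε : ∀ T, Measurable (ε₀ T))
    (ha : ∀ N, 0 < a N) (hl : l ≤ atTop ×ˢ atTop)
    (h : TailEquivInf (cdf (P.map θ₀)) (fun T => cdf (P.map (ε₀ T))) p a l)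
    {τ δ : ℝ} (hτ : 0 < τ) (hδ : 0 < δ) :
    ∀ᶠ s in l, quantileReal (P.map fun ω => θ₀ ω + 1 / (s.2 : ℝ) ^ p * ε₀ s.2 ω)
      (1 - 1 / (s.1 * τ)) ≤ quantileReal (P.map θ₀) (1 - 1 / (s.1 * τ)) + δ * a s.1 := by
  have hδ' : (0 : EReal) < (δ : ℝ) := by exact_mod_cast hδ
  filter_upwards [(h τ hτ).eventually (gt_mem_nhds hδ'), eventually_large (p := p) hl hτ one_pos]
    with s hs ⟨hv0, hv1, hc⟩
  have := Measure.isProbabilityMeasure_map (μ := P) hθ.aemeasurable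
  have := Measure.isProbabilityMeasure_map (μ := P) (hε s.2).aemeasurable
  have hsum : Measurable fun ω => θ₀ ω + 1 / (s.2 : ℝ) ^ p * ε₀ s.2 ω :=
    hθ.add ((hε s.2).const_mul _)
  have := Measure.isProbabilityMeasure_map (μ := P) hsum.aemeasurable
  simp only [iInf_lt_iff] at hs
  obtain ⟨u, hu, hs⟩ := hs
  have hu2 := hu.2
  have hu1 := hu.1
  set v := 1 - 1 / ((s.1 : ℝ) * τ) with hv
  have hv0' : 0 < v := by linarith
  have hv1' : v < 1 := by linarith
  have hinv : 0 < 1 / a s.1 := by have := ha s.1; positivity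
  have hFbot : quantile (cdf (P.map θ₀)) (v + u) ≠ ⊥ := quantile_ne_bot (by linarith)
  have hGbot : quantile (cdf (P.map (ε₀ s.2))) (1 - u) ≠ ⊥ := quantile_ne_bot (by linarith)
  rw [← coe_quantileReal hv0' hv1'] at hs
  -- The levels `v + u` and `1 - u` may equal `1`, where a quantile can be `+∞`; the bracket would
  -- then be `+∞`, not below `δ`.
  have hFtop : quantile (cdf (P.map θ₀)) (v + u) ≠ ⊤ := by
    intro htop
    rw [htop, EReal.top_sub_coe, EReal.top_add_of_ne_bot, EReal.coe_mul_top_of_pos hinv] at hs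
    · simp at hs
    · intro hb
      rw [EReal.mul_eq_bot] at hb
      rcases hb with ⟨h1, -⟩ | ⟨-, h1⟩ | ⟨h1, -⟩ | ⟨h1, -⟩
      · exact EReal.coe_ne_bot _ h1
      · exact hGbot h1
      · exact EReal.coe_ne_top _ h1
      · exact hc.not_gt (EReal.coe_neg'.1 h1)
  lift quantile (cdf (P.map θ₀)) (v + u) to ℝ using ⟨hFtop, hFbot⟩ with x hx
  have hGtop : quantile (cdf (P.map (ε₀ s.2))) (1 - u) ≠ ⊤ := by
    intro htop
    rw [htop, EReal.coe_mul_top_of_pos hc, ← EReal.coe_sub, EReal.coe_add_top,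
      EReal.coe_mul_top_of_pos hinv] at hs
    simp at hs
  lift quantile (cdf (P.map (ε₀ s.2))) (1 - u) to ℝ using ⟨hGtop, hGbot⟩ with y hy
  norm_cast at hs
  rw [one_div_mul_eq_div, div_lt_iff₀ (ha s.1)] at hs
  have h1 := quantile_le_coe_iff.1 hx.ge
  have h2 := quantile_le_coe_iff.1 hy.ge
  have h3 : v ≤ _ := le_trans (by linarith) (le_cdf_add_mul (P := P) (x := x) (y := y) hθ (hε s.2) hc)
  rw [← quantileReal_le_iff hv0' hv1'] at h3
  linarith

end Sum

/-! ### Domains of attraction and convergence of quantiles -/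

section Attraction

/-- The quantile function of the extreme value distribution with index `γ`, as a function of
`t = -log u`. -/
noncomputable def gevQuantile (γ t : ℝ) : ℝ :=
  if γ = 0 then -Real.log t else (t ^ (-γ) - 1) / γ

/-- With `gevCDF_lt_exp_neg`, this pins down `gevQuantile γ t` as the point where the extreme value
cdf crosses `exp (-t)`. Points outside the support are included, so no continuity of the cdf is
needed. -/
lemma exp_neg_lt_gevCDF {γ t x : ℝ} (ht : 0 < t) (hx : gevQuantile γ t < x) :
    Real.exp (-t) < gevCDF γ x := by
  rw [gevQuantile] at hx
  rw [gevCDF]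
  have htp : 0 < t ^ (-γ) := Real.rpow_pos_of_pos ht _
  split_ifs at hx ⊢ with h0 h1 h2
  · rw [Real.exp_lt_exp, neg_lt_neg_iff, ← Real.lt_log_iff_exp_lt ht]
    linarith
  · rw [Real.exp_lt_exp, neg_lt_neg_iff]
    have heq : (t ^ (-γ)) ^ (-1 / γ) = t := by
      rw [← Real.rpow_mul ht.le, show -γ * (-1 / γ) = 1 by field_simp, Real.rpow_one]
    conv_rhs => rw [← heq]
    rcases lt_or_gt_of_ne h0 with hneg | hpos
    · rw [div_lt_iff_of_neg hneg] at hx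
      exact Real.rpow_lt_rpow h1.le (by linarith) (div_pos_of_neg_of_neg (by norm_num) hneg)
    · rw [div_lt_iff₀ hpos] at hx
      exact Real.rpow_lt_rpow_of_neg htp (by linarith) (div_neg_of_neg_of_pos (by norm_num) hpos)
  · rw [div_lt_iff₀ h2] at hx
    linarith
  · rw [Real.exp_lt_one_iff]
    linarith

lemma gevCDF_lt_exp_neg {γ t x : ℝ} (ht : 0 < t) (hx : x < gevQuantile γ t) :
    gevCDF γ x < Real.exp (-t) := by
  rw [gevQuantile] at hx
  rw [gevCDF]
  have htp : 0 < t ^ (-γ) := Real.rpow_pos_of_pos ht _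
  split_ifs at hx ⊢ with h0 h1 h2
  · rw [Real.exp_lt_exp, neg_lt_neg_iff, ← Real.log_lt_iff_lt_exp ht]
    linarith
  · rw [Real.exp_lt_exp, neg_lt_neg_iff]
    have heq : (t ^ (-γ)) ^ (-1 / γ) = t := by
      rw [← Real.rpow_mul ht.le, show -γ * (-1 / γ) = 1 by field_simp, Real.rpow_one]
    conv_lhs => rw [← heq]
    rcases lt_or_gt_of_ne h0 with hneg | hpos
    · rw [lt_div_iff_of_neg hneg] at hx
      exact Real.rpow_lt_rpow htp.le (by linarith) (div_pos_of_neg_of_neg (by norm_num) hneg)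
    · rw [lt_div_iff₀ hpos] at hx
      exact Real.rpow_lt_rpow_of_neg h1 (by linarith) (div_neg_of_neg_of_pos (by norm_num) hpos)
  · positivity
  · have hneg : γ < 0 := lt_of_le_of_ne (not_lt.1 h2) h0
    rw [lt_div_iff_of_neg hneg] at hx
    linarith

lemma continuousOn_gevQuantile (γ : ℝ) : ContinuousOn (gevQuantile γ) (Set.Ioi 0) := by
  unfold gevQuantile
  split_ifs with h
  · exact (Real.continuousOn_log.mono fun x hx => (ne_of_gt hx : x ≠ 0)).neg
  · exact ((continuousOn_id.rpow_const fun x hx => Or.inl (ne_of_gt hx)).sub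
      continuousOn_const).div_const _

lemma gevQuantile_strictAntiOn (γ : ℝ) : StrictAntiOn (gevQuantile γ) (Set.Ioi 0) := by
  intro s hs t ht hst
  unfold gevQuantile
  have hs : 0 < s := hs
  split_ifs with h
  · exact neg_lt_neg (Real.log_lt_log hs hst)
  · rcases lt_or_gt_of_ne h with hneg | hpos
    · rw [div_lt_div_right_of_neg hneg]
      exact sub_lt_sub_right (Real.rpow_lt_rpow hs.le hst (by linarith)) _
    · rw [div_lt_div_iff_of_pos_right hpos]
      exact sub_lt_sub_right (Real.rpow_lt_rpow_of_neg hs hst (by linarith)) _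

variable {μ : Measure ℝ} {γ : ℝ} {α β : ℕ → ℝ}

lemma tendsto_one_sub_div_natCast_pow (t : ℝ) :
    Tendsto (fun N : ℕ => (1 - t / N) ^ N) atTop (𝓝 (Real.exp (-t))) := by
  refine (Real.tendsto_one_add_div_pow_exp (-t)).congr fun N => ?_
  rw [neg_div, ← sub_eq_add_neg]

lemma eventually_one_sub_div_mem {t : ℝ} (ht : 0 < t) :
    ∀ᶠ N : ℕ in atTop, (0 : ℝ) < N ∧ 0 < 1 - t / N ∧ 1 - t / N < 1 := by
  filter_upwards [tendsto_natCast_atTop_atTop.eventually_gt_atTop t] with N hN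
  have hN0 : (0 : ℝ) < N := ht.trans hN
  refine ⟨hN0, sub_pos.2 ((div_lt_one hN0).2 hN), ?_⟩
  have := div_pos ht hN0
  linarith

/-- Quantiles of a distribution attracted to the extreme value distribution, after
normalisation, converge to those of the latter. -/
lemma tendsto_quantileReal_div (hα : ∀ N, 0 < α N)
    (h : ∀ x : ℝ, Tendsto (fun N : ℕ => cdf μ (α N * x + β N) ^ N) atTop (𝓝 (gevCDF γ x)))
    {t : ℝ} (ht : 0 < t) :
    Tendsto (fun N : ℕ => (quantileReal μ (1 - t / N) - β N) / α N) atTop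
      (𝓝 (gevQuantile γ t)) := by
  refine tendsto_order.2 ⟨fun x hx => ?_, fun x hx => ?_⟩
  -- Since `(1 - t/N)^N → exp (-t)`, comparing `N`-th powers compares the cdf with the level `1 -
  -- t/N`.
  · filter_upwards [(h x).eventually_lt (tendsto_one_sub_div_natCast_pow t)
      (gevCDF_lt_exp_neg ht hx), eventually_one_sub_div_mem ht] with N hN ⟨_, h0, h1⟩
    have := lt_of_pow_lt_pow_left₀ N h0.le hN
    rw [← lt_quantileReal_iff h0 h1] at this
    rw [lt_div_iff₀ (hα N)]
    linarith
  -- The quantile equivalence only yields `≤`; the intermediate `y` restores strictness.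
  · obtain ⟨y, hy, hyx⟩ := exists_between hx
    filter_upwards [(tendsto_one_sub_div_natCast_pow t).eventually_lt (h y)
      (exp_neg_lt_gevCDF ht hy), eventually_one_sub_div_mem ht] with N hN ⟨_, h0, h1⟩
    have := (lt_of_pow_lt_pow_left₀ N (cdf_nonneg μ _) hN).le
    rw [← quantileReal_le_iff h0 h1] at this
    have h2 : y * α N < x * α N := mul_lt_mul_of_pos_right hyx (hα N)
    rw [div_lt_iff₀ (hα N)]
    linarith

/-- If `γ < 0`, the right endpoint is bounded through the increments of the tail quantiles. -/
lemma eventually_quantile_one_le (hα : ∀ N, 0 < α N)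
    (h : ∀ x : ℝ, Tendsto (fun N : ℕ => cdf μ (α N * x + β N) ^ N) atTop (𝓝 (gevCDF γ x)))
    (hγ : γ < 0) {ρ : ℝ} (hρ : (2 : ℝ) ^ γ < ρ) (hρ1 : ρ < 1) :
    ∀ᶠ N : ℕ in atTop, quantile (cdf μ) 1 ≤ ((quantileReal μ (1 - 1 / N) +
      (quantileReal μ (1 - (1 / 2) / N) - quantileReal μ (1 - 1 / N)) / (1 - ρ) : ℝ) : EReal) := by
  set U : ℕ → ℝ := fun N => quantileReal μ (1 - 1 / N) with hU
  -- Reading `U (2N)` and `U (4N)` as levels `t = 1/2, 1/4` at the same `N` lets all increments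
  -- share the normaliser `α N`.
  have hU2 : ∀ N : ℕ, quantileReal μ (1 - (1 / 2) / N) = U (2 * N) := fun N => by
    simp only [hU]; congr 2; push_cast; rw [div_div]
  have hU4 : ∀ N : ℕ, quantileReal μ (1 - (1 / 4) / N) = U (2 * (2 * N)) := fun N => by
    simp only [hU]; congr 2; push_cast; rw [div_div]; ring_nf
  have hlim1 := tendsto_quantileReal_div hα h one_pos
  have hlim2 := tendsto_quantileReal_div hα h (t := 1 / 2) (by norm_num)
  have hlim4 := tendsto_quantileReal_div hα h (t := 1 / 4) (by norm_num)
  have h2pos : (0 : ℝ) < 2 ^ γ := by positivity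
  have hρ0 : 0 < ρ := h2pos.trans hρ
  have hq2 : gevQuantile γ (1 / 2) = (2 ^ γ - 1) / γ := by
    rw [gevQuantile, if_neg hγ.ne, one_div, Real.inv_rpow (by norm_num), Real.rpow_neg (by norm_num),
      inv_inv]
  have hq4 : gevQuantile γ (1 / 4) = (2 ^ γ * 2 ^ γ - 1) / γ := by
    rw [gevQuantile, if_neg hγ.ne, one_div, Real.inv_rpow (by norm_num), Real.rpow_neg (by norm_num),
      inv_inv, show (4 : ℝ) = 2 * 2 by norm_num, Real.mul_rpow (by norm_num) (by norm_num)]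
  have hq1 : gevQuantile γ 1 = 0 := by
    rw [gevQuantile, if_neg hγ.ne, Real.one_rpow, sub_self, zero_div]
  -- The limiting ratio of successive increments is exactly `2 ^ γ`, which is below `ρ`.
  have hcmp : gevQuantile γ (1 / 4) - gevQuantile γ (1 / 2) <
      ρ * (gevQuantile γ (1 / 2) - gevQuantile γ 1) := by
    rw [hq2, hq4, hq1, sub_zero, ← sub_div, ← mul_div_assoc, div_lt_div_right_of_neg hγ]
    nlinarith
  have hinc : ∀ᶠ N : ℕ in atTop, U (2 * (2 * N)) - U (2 * N) ≤ ρ * (U (2 * N) - U N) := by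
    filter_upwards [(hlim4.sub hlim2).eventually_lt ((hlim2.sub hlim1).const_mul ρ) hcmp]
      with N hN
    rw [hU4, hU2, ← sub_div, ← sub_div, ← mul_div_assoc, div_lt_div_iff_of_pos_right (hα N)] at hN
    simp only [hU] at hN ⊢
    linarith
  obtain ⟨N₀, hN₀⟩ := eventually_atTop.1 hinc
  filter_upwards [eventually_ge_atTop N₀, eventually_gt_atTop 1] with N hN hN1
  have hUmono : ∀ M : ℕ, 1 < M → U M ≤ U (2 * M) := fun M hM => by
    have hM' : (1 : ℝ) < M := by exact_mod_cast hM
    refine quantileReal_mono (sub_pos.2 ?_) (sub_le_sub_left ?_ _) (sub_lt_self _ ?_)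
    · rw [div_lt_one] <;> linarith
    · push_cast
      exact one_div_le_one_div_of_le (by linarith) (by linarith)
    · push_cast; positivity
  have hρ' : 0 < 1 - ρ := by linarith
  -- Geometric series in telescoped form: `U M + (U (2M) - U M) / (1 - ρ)` does not increase when
  -- `M` is doubled.
  have hstep : ∀ k : ℕ, U (2 ^ k * N) + (U (2 * (2 ^ k * N)) - U (2 ^ k * N)) / (1 - ρ) ≤
      U N + (U (2 * N) - U N) / (1 - ρ) := by
    intro k
    induction k with
    | zero => simp
    | succ k ih =>
      refine le_trans ?_ ih
      have hge : N₀ ≤ 2 ^ k * N := hN.trans (Nat.le_mul_of_pos_left _ (by positivity))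
      have h1 := hN₀ _ hge
      rw [pow_succ', mul_assoc]
      set d := U (2 * (2 ^ k * N)) - U (2 ^ k * N) with hd
      have h2 : (U (2 * (2 * (2 ^ k * N))) - U (2 * (2 ^ k * N))) / (1 - ρ) ≤ ρ * d / (1 - ρ) :=
        div_le_div_of_nonneg_right h1 hρ'.le
      have h3 : d / (1 - ρ) = d + ρ * d / (1 - ρ) := by field_simp; ring
      linarith
  rw [hU2, quantile_le_coe_iff]
  have hle : ∀ k : ℕ, 1 - 1 / ((2 : ℝ) ^ k * N) ≤ cdf μ (U N + (U (2 * N) - U N) / (1 - ρ)) := by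
    intro k
    have hk1 : 1 < 2 ^ k * N := hN1.trans_le (Nat.le_mul_of_pos_left _ (by positivity))
    have hk1' : (1 : ℝ) < 2 ^ k * N := by exact_mod_cast hk1
    have h1 := hUmono _ hk1
    have h2 : U (2 ^ k * N) ≤ U N + (U (2 * N) - U N) / (1 - ρ) :=
      (le_add_of_nonneg_right (div_nonneg (sub_nonneg.2 h1) hρ'.le)).trans (hstep k)
    simp only [hU] at h2
    push_cast at h2
    simp only [hU]
    push_cast
    rwa [quantileReal_le_iff] at h2
    · rw [sub_pos, div_lt_one] <;> linarith
    · refine sub_lt_self _ (by positivity)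
  refine le_of_tendsto' (f := fun k : ℕ => 1 - 1 / ((2 : ℝ) ^ k * N)) (x := atTop) ?_ hle
  have h1 : Tendsto (fun k : ℕ => (2 : ℝ) ^ k * N) atTop atTop :=
    (tendsto_pow_atTop_atTop_of_one_lt (by norm_num)).atTop_mul_const (by positivity)
  simpa using (tendsto_const_nhds (x := (1 : ℝ))).sub (h1.inv_tendsto_atTop)

lemma quantile_one_lt_top (hα : ∀ N, 0 < α N)
    (h : ∀ x : ℝ, Tendsto (fun N : ℕ => cdf μ (α N * x + β N) ^ N) atTop (𝓝 (gevCDF γ x)))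
    (hγ : γ < 0) : quantile (cdf μ) 1 < ⊤ := by
  obtain ⟨ρ, hρ, hρ1⟩ := exists_between
    (Real.rpow_lt_one_of_one_lt_of_neg (by norm_num : (1 : ℝ) < 2) hγ)
  obtain ⟨N, hN⟩ := (eventually_quantile_one_le hα h hγ hρ hρ1).exists
  exact hN.trans_lt (EReal.coe_lt_top _)

/-- From below, the endpoint dominates the quantiles at `1 - t/N`, and `gevQuantile γ` is continuous
at `0` when `γ < 0`. From above, `eventually_quantile_one_le` is used with `ρ ↓ 2 ^ γ`, where its
normalised bound tends to `-1/γ`. -/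
lemma tendsto_quantileReal_one_div (hα : ∀ N, 0 < α N)
    (h : ∀ x : ℝ, Tendsto (fun N : ℕ => cdf μ (α N * x + β N) ^ N) atTop (𝓝 (gevCDF γ x)))
    (hγ : γ < 0) :
    Tendsto (fun N : ℕ => (quantileReal μ 1 - β N) / α N) atTop (𝓝 (gevQuantile γ 0)) := by
  have hcoe : (quantileReal μ 1 : EReal) = quantile (cdf μ) 1 :=
    EReal.coe_toReal (quantile_one_lt_top hα h hγ).ne (quantile_ne_bot one_pos)
  have hq0 : gevQuantile γ 0 = -1 / γ := by
    rw [gevQuantile, if_neg hγ.ne, Real.zero_rpow (by linarith), zero_sub]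
  refine tendsto_order.2 ⟨fun x hx => ?_, fun x hx => ?_⟩
  · have hcont : ContinuousAt (gevQuantile γ) 0 := by
      unfold gevQuantile
      simp only [if_neg hγ.ne]
      exact ((Real.continuousAt_rpow_const 0 (-γ) (Or.inr (by linarith))).sub_const 1).div_const γ
    obtain ⟨t, htx, ht⟩ := (((hcont.tendsto.eventually (lt_mem_nhds hx)).filter_mono
      nhdsWithin_le_nhds).and (self_mem_nhdsWithin (s := Set.Ioi (0 : ℝ)))).exists
    filter_upwards [(tendsto_quantileReal_div hα h ht).eventually (lt_mem_nhds htx),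
      eventually_one_sub_div_mem ht] with N hN ⟨_, h0, h1⟩
    refine hN.trans_le (div_le_div_of_nonneg_right (sub_le_sub_right ?_ _) (hα N).le)
    rw [← EReal.coe_le_coe_iff, hcoe, coe_quantileReal h0 h1]
    exact quantile_mono _ h1.le
  · have h2pos : (0 : ℝ) < 2 ^ γ := by positivity
    have h2lt : (2 : ℝ) ^ γ < 1 := Real.rpow_lt_one_of_one_lt_of_neg (by norm_num) hγ
    have hD : ContinuousAt (fun ρ : ℝ => ((2 ^ γ - 1) / γ) / (1 - ρ)) (2 ^ γ) :=
      continuousAt_const.div (by fun_prop) (by linarith)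
    have hDx : ((2 ^ γ - 1) / γ) / (1 - (2 : ℝ) ^ γ) < x := by
      have : ((2 ^ γ - 1) / γ) / (1 - (2 : ℝ) ^ γ) = -1 / γ := by
        have : 1 - (2 : ℝ) ^ γ ≠ 0 := by linarith
        have := hγ.ne
        field_simp
        ring
      rw [this, ← hq0]
      exact hx
    obtain ⟨ρ, ⟨hρx, hρ⟩, hρ1⟩ := (((hD.tendsto.eventually (gt_mem_nhds hDx)).filter_mono
      nhdsWithin_le_nhds).and (self_mem_nhdsWithin (s := Set.Ioi ((2 : ℝ) ^ γ)))).and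
      (((gt_mem_nhds h2lt).filter_mono nhdsWithin_le_nhds)) |>.exists
    have hlim1 := tendsto_quantileReal_div hα h one_pos
    have hlim2 := tendsto_quantileReal_div hα h (t := 1 / 2) (by norm_num)
    have hq1 : gevQuantile γ 1 = 0 := by
      rw [gevQuantile, if_neg hγ.ne, Real.one_rpow, sub_self, zero_div]
    have hq2 : gevQuantile γ (1 / 2) = (2 ^ γ - 1) / γ := by
      rw [gevQuantile, if_neg hγ.ne, one_div, Real.inv_rpow (by norm_num),
        Real.rpow_neg (by norm_num), inv_inv]
    have hlim := hlim1.add ((hlim2.sub hlim1).div_const (1 - ρ))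
    rw [hq1, hq2, sub_zero, zero_add] at hlim
    filter_upwards [hlim.eventually (gt_mem_nhds hρx), eventually_quantile_one_le hα h hγ hρ hρ1]
      with N hN hN2
    refine lt_of_le_of_lt ?_ hN
    rw [← hcoe, EReal.coe_le_coe_iff] at hN2
    rw [← sub_div, div_right_comm, ← add_div]
    refine div_le_div_of_nonneg_right ?_ (hα N).le
    rw [sub_sub_sub_cancel_right]
    linarith

end Attraction

/-! ### Comparison of normalising constants -/

section Scale

variable {Ω Ω₁ : Type*} [MeasurableSpace Ω] [MeasurableSpace Ω₁]

/-- Otherwise no mass lies above any point exceeding a member of `A = {s | P₁ (X < s) ≠ 0}`, and all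
the mass sits at `sInf A`. -/
lemma exists_lt_measure_pos {P₁ : Measure Ω₁} [IsProbabilityMeasure P₁] {X : Ω₁ → ℝ}
    (hX : ∀ c : ℝ, ¬ ∀ᵐ ω ∂P₁, X ω = c) :
    ∃ s t : ℝ, s < t ∧ P₁ {ω | X ω < s} ≠ 0 ∧ P₁ {ω | t < X ω} ≠ 0 := by
  by_contra! hcon
  have hfin : ∃ s : ℝ, P₁ {ω | X ω < s} ≠ 0 := by
    by_contra! h
    have h1 : P₁ (⋃ n : ℕ, {ω | X ω < n}) = 0 := measure_iUnion_null fun n => h n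
    have h2 : (⋃ n : ℕ, {ω | X ω < n}) = Set.univ := by
      ext ω; simpa using exists_nat_gt (X ω)
    simp [h2] at h1
  set A : Set ℝ := {s | P₁ {ω | X ω < s} ≠ 0} with hA
  have hup : ∀ s ∈ A, ∀ t, s < t → P₁ {ω | t < X ω} = 0 := fun s hs t hst => hcon s t hst hs
  have hbdd : BddBelow A := by
    by_contra hb
    rw [not_bddBelow_iff] at hb
    have h1 : P₁ (⋃ n : ℕ, {ω | -(n : ℝ) < X ω}) = 0 := measure_iUnion_null fun n => by
      obtain ⟨s, hs, hsn⟩ := hb (-n)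
      exact hup s hs _ hsn
    have h2 : (⋃ n : ℕ, {ω | -(n : ℝ) < X ω}) = Set.univ := by
      ext ω
      obtain ⟨n, hn⟩ := exists_nat_gt (-X ω)
      simp only [Set.mem_iUnion, Set.mem_univ, iff_true]
      exact ⟨n, by simp only [Set.mem_ofPred_eq]; linarith⟩
    simp [h2] at h1
  have hpos : ∀ n : ℕ, (0 : ℝ) < 1 / ((n : ℝ) + 1) := fun n => by positivity
  have hsmall : ∀ d : ℝ, 0 < d → ∃ n : ℕ, 1 / ((n : ℝ) + 1) < d := fun d hd =>
    exists_nat_one_div_lt hd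
  refine hX (sInf A) ?_
  have hlow : P₁ (⋃ n : ℕ, {ω | X ω < sInf A - 1 / ((n : ℝ) + 1)}) = 0 :=
    measure_iUnion_null fun n => by
      by_contra h
      have := csInf_le hbdd (show sInf A - 1 / ((n : ℝ) + 1) ∈ A from h)
      linarith [hpos n]
  have hhigh : P₁ (⋃ n : ℕ, {ω | sInf A + 1 / ((n : ℝ) + 1) < X ω}) = 0 :=
    measure_iUnion_null fun n => by
      obtain ⟨s, hs, hlt⟩ := exists_lt_of_csInf_lt hfin
        (show sInf A < sInf A + 1 / ((n : ℝ) + 1) by linarith [hpos n])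
      exact hup s hs _ hlt
  rw [ae_iff]
  refine measure_mono_null (fun ω hω => ?_) (measure_union_null hlow hhigh)
  have hω : X ω ≠ sInf A := hω
  rcases lt_or_gt_of_ne hω with h | h
  · obtain ⟨n, hn⟩ := hsmall _ (sub_pos.2 h)
    exact Or.inl (Set.mem_iUnion.2 ⟨n, by simp only [Set.mem_ofPred_eq]; linarith⟩)
  · obtain ⟨n, hn⟩ := hsmall _ (sub_pos.2 h)
    exact Or.inr (Set.mem_iUnion.2 ⟨n, by simp only [Set.mem_ofPred_eq]; linarith⟩)

/-- The portmanteau inequality for open sets, giving a uniform lower bound on the mass. -/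
lemma exists_eventually_lt_measureReal_preimage {P : Measure Ω} [IsProbabilityMeasure P]
    {P₁ : Measure Ω₁} [IsProbabilityMeasure P₁] {X : Ω₁ → ℝ} {Y : ℕ → Ω → ℝ}
    (h : TendstoInDistribution Y atTop X (fun _ => P) P₁) {G : Set ℝ} (hG : IsOpen G)
    (h0 : P₁ (X ⁻¹' G) ≠ 0) :
    ∃ d : ℝ, 0 < d ∧ d < 1 ∧ ∀ᶠ N in atTop, d < P.real (Y N ⁻¹' G) := by
  obtain ⟨d, hd0, hd⟩ := exists_between (pos_iff_ne_zero.2 h0)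
  have hd1 : d < 1 := hd.trans_le prob_le_one
  have h1 := ProbabilityMeasure.le_liminf_measure_open_of_tendsto h.tendsto hG
  simp only [ProbabilityMeasure.coe_mk] at h1
  rw [Measure.map_apply_of_aemeasurable h.aemeasurable_limit hG.measurableSet] at h1
  refine ⟨d.toReal, ENNReal.toReal_pos hd0.ne' hd1.ne_top, ?_, ?_⟩
  · rw [← ENNReal.toReal_one]
    exact (ENNReal.toReal_lt_toReal hd1.ne_top ENNReal.one_ne_top).2 hd1
  · filter_upwards [eventually_lt_of_lt_liminf (hd.trans_le h1)] with N hN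
    rw [Measure.map_apply_of_aemeasurable (h.forall_aemeasurable N) hG.measurableSet] at hN
    exact (ENNReal.toReal_lt_toReal hd1.ne_top (measure_ne_top _ _)).2 hN

/-- If maxima normalised with `α, β` converge to an extreme value distribution, and normalised with
`a, b` to a nondegenerate limit, then `a = O(α)`. -/
lemma exists_eventually_le_mul {P : Measure Ω} [IsProbabilityMeasure P]
    {P₁ : Measure Ω₁} [IsProbabilityMeasure P₁] {X : Ω₁ → ℝ} {M : ℕ → Ω → ℝ}
    {α β a b : ℕ → ℝ} {γ : ℝ} (hα : ∀ N, 0 < α N) (ha : ∀ N, 0 < a N)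
    (hMm : ∀ N, Measurable (M N))
    (hM : ∀ x : ℝ, Tendsto (fun N : ℕ => P.real {ω | M N ω ≤ α N * x + β N}) atTop
      (𝓝 (gevCDF γ x)))
    (hX : ∀ c : ℝ, ¬ ∀ᵐ ω ∂P₁, X ω = c)
    (hmax : TendstoInDistribution (fun N ω => (M N ω - b N) / a N) atTop X (fun _ => P) P₁) :
    ∃ C : ℝ, 0 < C ∧ ∀ᶠ N in atTop, a N ≤ C * α N := by
  obtain ⟨s, t, hst, hs, ht⟩ := exists_lt_measure_pos hX
  obtain ⟨d, hd0, hd1, hd⟩ := exists_eventually_lt_measureReal_preimage hmax isOpen_Iio hs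
  obtain ⟨e, he0, he1, he⟩ := exists_eventually_lt_measureReal_preimage hmax isOpen_Ioi ht
  have hlow : ∃ y, gevCDF γ y < d := by
    have hlog : 0 < 1 - Real.log d := by have := Real.log_neg hd0 hd1; linarith
    refine ⟨gevQuantile γ (1 - Real.log d) - 1, (gevCDF_lt_exp_neg hlog (by linarith)).trans ?_⟩
    rw [← Real.lt_log_iff_exp_lt hd0]
    linarith
  have hhigh : ∃ x, 1 - e < gevCDF γ x := by
    have hlog : 0 < -Real.log (1 - e) := by
      have := Real.log_neg (show 0 < 1 - e by linarith) (by linarith); linarith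
    refine ⟨gevQuantile γ (-Real.log (1 - e)) + 1,
      lt_of_eq_of_lt ?_ (exp_neg_lt_gevCDF hlog (by linarith))⟩
    rw [neg_neg, Real.exp_log (by linarith)]
  obtain ⟨y, hy⟩ := hlow
  obtain ⟨x, hx⟩ := hhigh
  -- The events below show `α y + β < b + a s` and `b + a t < α x + β`; subtracting, `a (t - s) < α
  -- (x - y)`. The maximum with `1` makes positivity of the constant immediate.
  have hC : 0 < max (x - y) 1 := lt_max_of_lt_right one_pos
  refine ⟨max (x - y) 1 / (t - s), div_pos hC (sub_pos.2 hst), ?_⟩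
  filter_upwards [hd, he, (hM y).eventually (gt_mem_nhds hy), (hM x).eventually (lt_mem_nhds hx)]
    with N h1 h2 h3 h4
  have h5 : α N * y + β N < b N + a N * s := by
    by_contra! hle
    refine (h1.trans_le (measureReal_mono fun ω hω => ?_)).not_gt h3
    have hω : (M N ω - b N) / a N < s := hω
    rw [div_lt_iff₀ (ha N)] at hω
    simp only [Set.mem_ofPred_eq]
    linarith
  have h6 : b N + a N * t < α N * x + β N := by
    by_contra! hle
    have h7 : P.real ({ω | M N ω ≤ α N * x + β N}ᶜ) < e := by
      rw [probReal_compl_eq_one_sub (measurableSet_le (hMm N) measurable_const)]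
      linarith
    refine (h2.trans_le (measureReal_mono fun ω hω => ?_)).not_gt h7
    have hω : t < (M N ω - b N) / a N := hω
    rw [lt_div_iff₀ (ha N)] at hω
    simp only [Set.mem_compl_iff, Set.mem_ofPred_eq, not_le]
    linarith
  rw [div_mul_eq_mul_div, le_div_iff₀ (sub_pos.2 hst)]
  have h8 : α N * (x - y) ≤ α N * max (x - y) 1 :=
    mul_le_mul_of_nonneg_left (le_max_left _ _) (hα N).le
  nlinarith

end Scale

/-! ### Order statistics of independent exponential variables -/

section Renyi

open scoped Nat

/-- The entry of index `j` in the sorted vector is `≤ t` exactly when more than `j` coordinates are.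
-/
lemma measurable_comp_sort (n : ℕ) : Measurable fun x : Fin n → ℝ => x ∘ Tuple.sort x := by
  rw [measurable_pi_iff]
  intro j
  refine measurable_of_Iic fun t => ?_
  have hset : (fun x : Fin n → ℝ => (x ∘ Tuple.sort x) j) ⁻¹' Set.Iic t =
      {x | (j : ℕ) < ∑ i, if x i ≤ t then 1 else 0} := by
    ext x
    have hcard : Finset.card {i | (x ∘ Tuple.sort x) i ≤ t} = Finset.card {i | x i ≤ t} :=
      Finset.card_equiv (Tuple.sort x) (by simp)
    rw [Set.mem_preimage, Set.mem_Iic, ← Tuple.lt_card_le_iff_apply_le_of_monotone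
      (Tuple.monotone_sort x), hcard, Finset.card_filter]
    rfl
  rw [hset]
  refine measurableSet_lt measurable_const (Finset.measurable_sum _ fun i _ => ?_)
  exact Measurable.ite (measurableSet_le (measurable_pi_apply i) measurable_const)
    measurable_const measurable_const

lemma lintegral_pi_prod_eq_prod {n : ℕ} (μ : Fin n → Measure ℝ) [∀ i, SigmaFinite (μ i)]
    {f : Fin n → ℝ → ENNReal} (hf : ∀ i, Measurable (f i)) :
    ∫⁻ x, ∏ i, f i (x i) ∂(Measure.pi μ) = ∏ i, ∫⁻ x, f i x ∂(μ i) := by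
  induction n with
  | zero => simp
  | succ n ih =>
    have hmeas : Measurable fun x : Fin n → ℝ => ∏ i : Fin n, f i.succ (x i) :=
      Finset.measurable_prod _ fun i _ => (hf _).comp (measurable_pi_apply i)
    rw [← ((measurePreserving_piFinSuccAbove μ 0).symm).lintegral_comp_emb
      (MeasurableEquiv.measurableEmbedding _)]
    simp_rw [MeasurableEquiv.piFinSuccAbove_symm_apply, Fin.insertNthEquiv,
      Fin.prod_univ_succ, Fin.insertNth_zero, Equiv.coe_fn_mk, Fin.cons_succ,
      Fin.zero_succAbove, cast_eq, Fin.cons_zero]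
    rw [lintegral_prod_mul (hf 0).aemeasurable hmeas.aemeasurable,
      ih (fun i => μ i.succ) fun i => hf i.succ]

lemma pi_withDensity {n : ℕ} (μ : Measure ℝ) [SigmaFinite μ] {f : ℝ → ENNReal}
    (hf : Measurable f) [SigmaFinite (μ.withDensity f)] :
    Measure.pi (fun _ : Fin n => μ.withDensity f) =
      (Measure.pi fun _ : Fin n => μ).withDensity fun x => ∏ i, f (x i) := by
  refine Measure.pi_eq fun s hs => ?_
  rw [withDensity_apply _ (MeasurableSet.univ_pi hs), Measure.restrict_pi_pi,
    lintegral_pi_prod_eq_prod _ fun _ => hf]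
  exact Finset.prod_congr rfl fun i _ => (withDensity_apply _ (hs i)).symm

/-- Ties lie in finitely many proper subspaces, each Lebesgue-null. -/
lemma ae_injective_pi (n : ℕ) : ∀ᵐ x : Fin n → ℝ, Function.Injective x := by
  have h : ∀ i j : Fin n, i ≠ j → ∀ᵐ x : Fin n → ℝ, x i ≠ x j := by
    intro i j hij
    let K : Submodule ℝ (Fin n → ℝ) :=
      LinearMap.ker ((LinearMap.proj i : (Fin n → ℝ) →ₗ[ℝ] ℝ) - LinearMap.proj j)
    have hK : K ≠ ⊤ := by
      intro htop
      have h1 : (Pi.single i 1 : Fin n → ℝ) ∈ K := htop ▸ Submodule.mem_top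
      simp [K, hij.symm] at h1
    have h0 := Measure.addHaar_submodule (volume : Measure (Fin n → ℝ)) K hK
    rw [ae_iff]
    refine measure_mono_null (fun x hx => ?_) h0
    simp only [ne_eq, not_not, Set.mem_ofPred_eq] at hx
    simp [K, hx]
  have h' : ∀ᵐ x : Fin n → ℝ, ∀ i j : Fin n, i ≠ j → x i ≠ x j := by
    simp only [ae_all_iff]
    exact h
  filter_upwards [h'] with x hx i j hij
  by_contra hne
  exact hx i j hne hij

lemma ae_forall_ne_zero (n : ℕ) : ∀ᵐ x : Fin n → ℝ, ∀ i, x i ≠ 0 := by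
  rw [ae_all_iff]
  intro i
  have h0 := Measure.pi_hyperplane (fun _ : Fin n => (volume : Measure ℝ)) i 0
  rw [ae_iff]
  simp only [not_not]
  exact h0

lemma measurableSet_strictMono (n : ℕ) : MeasurableSet {x : Fin n → ℝ | StrictMono x} := by
  have : {x : Fin n → ℝ | StrictMono x} =
      ⋂ (i : Fin n) (j : Fin n) (_ : i < j), {x | x i < x j} := by
    ext x; simp [StrictMono]
  rw [this]
  exact MeasurableSet.iInter fun i => MeasurableSet.iInter fun j => MeasurableSet.iInter fun _ =>
    measurableSet_lt (measurable_pi_apply i) (measurable_pi_apply j)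

lemma measurePreserving_comp_perm {n : ℕ} (σ : Equiv.Perm (Fin n)) :
    MeasurePreserving (fun x : Fin n → ℝ => x ∘ σ) volume volume := by
  convert volume_measurePreserving_piCongrLeft (fun _ : Fin n => ℝ) σ.symm using 1
  ext x i
  have := MeasurableEquiv.piCongrLeft_apply_apply (β := fun _ : Fin n => ℝ) σ.symm x (σ i)
  simpa using this.symm

/-- Integrating a function of the sorted vector amounts to integrating over the cone of increasing
vectors, up to the number of permutations. -/
lemma lintegral_comp_sort {n : ℕ} {ψ : (Fin n → ℝ) → ENNReal} (hψ : Measurable ψ) :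
    ∫⁻ x : Fin n → ℝ, ψ (x ∘ Tuple.sort x) =
      (n ! : ENNReal) * ∫⁻ x, {x : Fin n → ℝ | StrictMono x}.indicator ψ x := by
  set ψ' := {x : Fin n → ℝ | StrictMono x}.indicator ψ with hψ'
  have hψ'm : Measurable ψ' := hψ.indicator (measurableSet_strictMono n)
  have hae : ∀ᵐ x : Fin n → ℝ, ψ (x ∘ Tuple.sort x) = ∑ σ : Equiv.Perm (Fin n), ψ' (x ∘ σ) := by
    filter_upwards [ae_injective_pi n] with x hx
    -- Without ties, exactly one permutation makes `x` increasing.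
    rw [Finset.sum_eq_single (Tuple.sort x)]
    · rw [hψ', Set.indicator_of_mem]
      exact (Tuple.monotone_sort x).strictMono_of_injective (hx.comp (Tuple.sort x).injective)
    · intro σ _ hσ
      rw [hψ', Set.indicator_of_notMem]
      intro hmono
      have h1 := Tuple.unique_monotone (StrictMono.monotone hmono) (Tuple.monotone_sort x)
      exact hσ (Equiv.ext fun i => hx (congrFun h1 i))
    · simp
  rw [lintegral_congr_ae hae, lintegral_finsetSum]
  · simp_rw [fun σ : Equiv.Perm (Fin n) => (measurePreserving_comp_perm σ).lintegral_comp hψ'm]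
    simp [Fintype.card_perm]
  · exact fun σ _ => hψ'm.comp (measurePreserving_comp_perm σ).measurable

/-- The linear map which sends independent standard exponential variables to the order statistics
of an independent sample of such variables. -/
noncomputable def renyiMap (n : ℕ) : (Fin n → ℝ) →ₗ[ℝ] (Fin n → ℝ) :=
  Matrix.toLin' (Matrix.of fun j i : Fin n => if i ≤ j then ((n : ℝ) - i)⁻¹ else 0)

lemma renyiMap_apply {n : ℕ} (e : Fin n → ℝ) (j : Fin n) :
    renyiMap n e j = ∑ i ∈ Finset.Iic j, e i / ((n : ℝ) - i) := by
  rw [renyiMap, Matrix.toLin'_apply, Matrix.mulVec, dotProduct]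
  simp only [Matrix.of_apply, ite_mul, zero_mul]
  rw [← Finset.sum_filter]
  refine Finset.sum_congr ?_ fun i _ => by rw [div_eq_inv_mul]
  ext i; simp

lemma natCast_sub_fin_pos {n : ℕ} (i : Fin n) : (0 : ℝ) < (n : ℝ) - i := by
  have : (i : ℝ) < n := by exact_mod_cast i.2
  linarith

/-- The matrix is lower triangular with diagonal `1/(n - i)`. Changing variables thus produces the
same factor `n!` as sorting does in `lintegral_comp_sort`. -/
lemma det_renyiMap (n : ℕ) : LinearMap.det (renyiMap n) = ((n ! : ℝ))⁻¹ := by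
  rw [renyiMap, LinearMap.det_toLin', Matrix.det_of_isLowerTriangular]
  · simp only [Matrix.of_apply, le_refl, if_true]
    rw [Finset.prod_inv_distrib, inv_inj]
    rw [Fin.prod_univ_eq_prod_range (fun i => (n : ℝ) - i) n, ← Nat.descFactorial_self,
      Nat.descFactorial_eq_prod_range, Nat.cast_prod]
    exact Finset.prod_congr rfl fun i hi => (Nat.cast_sub (Finset.mem_range.1 hi).le).symm
  · intro i j hij
    simp only [Matrix.of_apply]
    rw [if_neg]
    exact not_le.2 hij

/-- Each `e i` enters `n - i` coordinates with weight `1/(n - i)`. As the exponential density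
depends on the sum only, it is preserved. -/
lemma sum_renyiMap {n : ℕ} (e : Fin n → ℝ) : ∑ j, renyiMap n e j = ∑ i, e i := by
  simp_rw [renyiMap_apply]
  rw [Finset.sum_comm' (t' := Finset.univ) (s' := fun i => Finset.Ici i) (by simp)]
  refine Finset.sum_congr rfl fun i _ => ?_
  rw [Finset.sum_const, Fin.card_Ici, nsmul_eq_mul, Nat.cast_sub i.2.le]
  have := (natCast_sub_fin_pos i).ne'
  field_simp

lemma renyiMap_sub {n : ℕ} (e : Fin n → ℝ) {i j : Fin n} (hij : i < j) :
    renyiMap n e j - renyiMap n e i = ∑ k ∈ Finset.Ioc i j, e k / ((n : ℝ) - k) := by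
  rw [renyiMap_apply, renyiMap_apply, sub_eq_iff_eq_add, add_comm]
  rw [← Finset.sum_union]
  · refine Finset.sum_congr ?_ fun _ _ => rfl
    ext k
    simp only [Finset.mem_Iic, Finset.mem_union, Finset.mem_Ioc]
    constructor
    · intro hk
      rcases le_or_gt k i with h | h
      · exact Or.inl h
      · exact Or.inr ⟨h, hk⟩
    · rintro (h | h)
      · exact h.trans hij.le
      · exact h.2
  · rw [Finset.disjoint_left]
    intro k hk hk'
    exact (Finset.mem_Ioc.1 hk').1.not_ge (Finset.mem_Iic.1 hk)

lemma prod_exponentialPDF_eq {n : ℕ} {x : Fin n → ℝ} (hx : ∀ i, 0 ≤ x i) :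
    ∏ i, exponentialPDF 1 (x i) = ENNReal.ofReal (Real.exp (-∑ i, x i)) := by
  rw [← Finset.sum_neg_distrib, Real.exp_sum, ENNReal.ofReal_prod_of_nonneg]
  · refine Finset.prod_congr rfl fun i _ => ?_
    rw [exponentialPDF_of_nonneg (hx i)]
    simp
  · exact fun i _ => (Real.exp_pos _).le

lemma prod_exponentialPDF_eq_zero {n : ℕ} {x : Fin n → ℝ} {i : Fin n} (hx : x i < 0) :
    ∏ i, exponentialPDF 1 (x i) = 0 :=
  Finset.prod_eq_zero (Finset.mem_univ i) (exponentialPDF_of_neg hx)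

/-- The spacings of the image are positive multiples of the entries of `e`, so positive vectors map
to increasing positive ones with equal density. For any other `e` both sides vanish. -/
lemma indicator_strictMono_renyiMap {n : ℕ} {e : Fin n → ℝ} (he : ∀ i, e i ≠ 0)
    (Φ : (Fin n → ℝ) → ENNReal) :
    {x : Fin n → ℝ | StrictMono x}.indicator
      (fun x => (∏ i, exponentialPDF 1 (x i)) * Φ x) (renyiMap n e) =
      (∏ i, exponentialPDF 1 (e i)) * Φ (renyiMap n e) := by
  by_cases hpos : ∀ i, 0 < e i
  · have hmono : StrictMono (renyiMap n e) := by
      intro i j hij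
      rw [← sub_pos, renyiMap_sub e hij]
      exact Finset.sum_pos (fun k _ => div_pos (hpos k) (natCast_sub_fin_pos k))
        ⟨j, Finset.mem_Ioc.2 ⟨hij, le_rfl⟩⟩
    rw [Set.indicator_of_mem (by exact hmono), prod_exponentialPDF_eq fun i => (hpos i).le,
      prod_exponentialPDF_eq, sum_renyiMap]
    intro j
    rw [renyiMap_apply]
    exact Finset.sum_nonneg fun k _ => (div_pos (hpos k) (natCast_sub_fin_pos k)).le
  · push Not at hpos
    obtain ⟨j, hj⟩ := hpos
    have hj : e j < 0 := lt_of_le_of_ne hj (he j)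
    rw [prod_exponentialPDF_eq_zero hj, zero_mul]
    by_cases hmono : StrictMono (renyiMap n e)
    · rw [Set.indicator_of_mem (by exact hmono)]
      -- A negative first entry makes the first image coordinate negative, where the density is
      -- zero; any later negative entry contradicts monotonicity.
      rcases Nat.eq_zero_or_pos j with h0 | h0
      · have hneg : renyiMap n e j < 0 := by
          have hIic : Finset.Iic j = {j} := by
            ext k
            simp only [Finset.mem_Iic, Finset.mem_singleton, Fin.le_def, Fin.ext_iff]
            omega
          rw [renyiMap_apply, hIic, Finset.sum_singleton]
          exact div_neg_of_neg_of_pos hj (natCast_sub_fin_pos j)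
        rw [prod_exponentialPDF_eq_zero hneg, zero_mul]
      · exfalso
        let i : Fin n := ⟨j - 1, by omega⟩
        have hij : i < j := by rw [Fin.lt_def]; simp only [i]; omega
        have hIoc : Finset.Ioc i j = {j} := by
          ext k
          simp only [Finset.mem_Ioc, Finset.mem_singleton, Fin.le_def, Fin.lt_def, Fin.ext_iff, i]
          omega
        have h1 := sub_pos.2 (hmono hij)
        rw [renyiMap_sub e hij, hIoc, Finset.sum_singleton] at h1
        exact h1.not_gt (div_neg_of_neg_of_pos hj (natCast_sub_fin_pos j))
    · rw [Set.indicator_of_notMem (by exact hmono)]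

lemma measurable_renyiMap (n : ℕ) : Measurable (renyiMap n) :=
  (LinearMap.continuous_of_finiteDimensional _).measurable

lemma lintegral_comp_renyiMap {n : ℕ} {ψ : (Fin n → ℝ) → ENNReal} (hψ : Measurable ψ) :
    ∫⁻ e, ψ (renyiMap n e) = (n ! : ENNReal) * ∫⁻ x, ψ x := by
  have hdet : LinearMap.det (renyiMap n) ≠ 0 := by
    rw [det_renyiMap]; positivity
  rw [← lintegral_map hψ (measurable_renyiMap n),
    Real.map_linearMap_volume_pi_eq_smul_volume_pi hdet, lintegral_smul_measure, det_renyiMap,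
    inv_inv, Nat.abs_cast, ENNReal.ofReal_natCast, smul_eq_mul]

lemma expMeasure_eq_withDensity (r : ℝ) :
    expMeasure r = volume.withDensity (exponentialPDF r) := rfl

lemma measurable_exponentialPDF (r : ℝ) : Measurable (exponentialPDF r) :=
  (measurable_exponentialPDFReal r).ennreal_ofReal

/-- **Rényi's representation** of the order statistics of independent exponential variables. -/
theorem map_comp_sort_pi_expMeasure (n : ℕ) :
    (Measure.pi fun _ : Fin n => expMeasure 1).map (fun x => x ∘ Tuple.sort x) =
      (Measure.pi fun _ : Fin n => expMeasure 1).map (renyiMap n) := by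
  have hprob : IsProbabilityMeasure (volume.withDensity (exponentialPDF 1)) :=
    isProbabilityMeasure_expMeasure one_pos
  have hg : Measurable fun x : Fin n → ℝ => ∏ i, exponentialPDF 1 (x i) :=
    Finset.measurable_prod _ fun i _ => (measurable_exponentialPDF 1).comp (measurable_pi_apply i)
  refine Measure.ext_of_lintegral _ fun Φ hΦ => ?_
  rw [lintegral_map hΦ (measurable_comp_sort n), lintegral_map hΦ (measurable_renyiMap n),
    expMeasure_eq_withDensity, pi_withDensity volume (measurable_exponentialPDF 1),
    lintegral_withDensity_eq_lintegral_mul _ hg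
      (g := fun x => Φ (x ∘ Tuple.sort x)) (hΦ.comp (measurable_comp_sort n)),
    lintegral_withDensity_eq_lintegral_mul _ hg
      (g := fun x => Φ (renyiMap n x)) (hΦ.comp (measurable_renyiMap n))]
  have hψ : Measurable fun x : Fin n → ℝ => (∏ i, exponentialPDF 1 (x i)) * Φ x := hg.mul hΦ
  calc ∫⁻ x : Fin n → ℝ, (∏ i, exponentialPDF 1 (x i)) * Φ (x ∘ Tuple.sort x)
      = ∫⁻ x : Fin n → ℝ, (fun x : Fin n → ℝ => (∏ i, exponentialPDF 1 (x i)) * Φ x)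
          (x ∘ Tuple.sort x) := by
        refine lintegral_congr fun x => ?_
        simp only [Function.comp_apply]
        rw [Equiv.prod_comp (Tuple.sort x) fun i => exponentialPDF 1 (x i)]
    _ = ∫⁻ e, {x : Fin n → ℝ | StrictMono x}.indicator
          (fun x => (∏ i, exponentialPDF 1 (x i)) * Φ x) (renyiMap n e) := by
        rw [lintegral_comp_sort hψ,
          lintegral_comp_renyiMap (hψ.indicator (measurableSet_strictMono n))]
    _ = ∫⁻ e : Fin n → ℝ, (∏ i, exponentialPDF 1 (e i)) * Φ (renyiMap n e) := by
        refine lintegral_congr_ae ?_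
        filter_upwards [ae_forall_ne_zero n] with e he
        exact indicator_strictMono_renyiMap he Φ

end Renyi

/-! ### Order statistics as functions of the sample vector -/

section OrderStatistics

/-- The `k`-th smallest entry of a vector. -/
noncomputable def orderVec {N : ℕ} (y : Fin N → ℝ) (k : ℕ) : ℝ :=
  if h : 1 ≤ k ∧ k ≤ N then (y ∘ Tuple.sort y) ⟨k - 1, by omega⟩ else 0

lemma orderStat_eq_orderVec (x : ℕ → ℝ) (k N : ℕ) :
    orderStat x k N = orderVec (fun i : Fin N => x i) k := rfl

lemma measurable_orderVec {N : ℕ} (k : ℕ) : Measurable fun y : Fin N → ℝ => orderVec y k := by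
  unfold orderVec
  split_ifs with h
  · exact (measurable_pi_apply _).comp (measurable_comp_sort N)
  · exact measurable_const

lemma orderVec_self_le_iff {N : ℕ} (hN : 1 ≤ N) (y : Fin N → ℝ) (t : ℝ) :
    orderVec y N ≤ t ↔ ∀ i, y i ≤ t := by
  rw [orderVec, dif_pos ⟨hN, le_rfl⟩]
  refine ⟨fun h i => ?_, fun h => h _⟩
  refine le_trans ?_ h
  have h1 := Tuple.monotone_sort y
    (show (Tuple.sort y).symm i ≤ ⟨N - 1, by omega⟩ by rw [Fin.le_def]; simp only; omega)
  simpa using h1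

/-- An antitone transformation exchanges upper and lower order statistics. -/
lemma orderVec_comp_antitoneOn {N : ℕ} {h : ℝ → ℝ} (hh : AntitoneOn h (Set.Ioi 0))
    {v : Fin N → ℝ} (hv : ∀ i, 0 < v i) {j : ℕ} (hj : j < N) :
    orderVec (fun i => h (v i)) (N - j) = h ((v ∘ Tuple.sort v) ⟨j, hj⟩) := by
  rw [orderVec, dif_pos ⟨by omega, by omega⟩]
  -- Sorting `v` and reversing yields a sorted arrangement of `h ∘ v`; sorted arrangements agree as
  -- vectors even with ties.
  have hmono : Monotone ((fun i => h (v i)) ∘ (Fin.revPerm.trans (Tuple.sort v))) := by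
    intro i k hik
    exact hh (hv _) (hv _) (Tuple.monotone_sort v (Fin.rev_le_rev.2 hik))
  rw [Tuple.unique_monotone (Tuple.monotone_sort _) hmono]
  simp only [Function.comp_apply, Equiv.trans_apply, Fin.revPerm_apply]
  congr 3
  rw [Fin.ext_iff, Fin.val_rev]
  simp only
  omega

variable {Ω : Type*} [MeasurableSpace Ω] {P : Measure Ω}

lemma map_fin_eq_pi {x : ℕ → Ω → ℝ} {μ : Measure ℝ} (hx : ∀ i, AEMeasurable (x i) P)
    (hind : iIndepFun x P) (hlaw : ∀ i, P.map (x i) = μ) (N : ℕ) :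
    P.map (fun ω (i : Fin N) => x i ω) = Measure.pi fun _ : Fin N => μ := by
  have h := iIndepFun.map_fun_eq_pi_map (f := fun i : Fin N => x i) (fun i => hx i)
    (hind.precomp (g := fun i : Fin N => (i : ℕ)) Fin.val_injective)
  simp_rw [hlaw] at h
  exact h

lemma measureReal_orderStat_self_le {x : ℕ → Ω → ℝ} {μ : Measure ℝ} [IsProbabilityMeasure μ]
    (hx : ∀ i, Measurable (x i)) (hind : iIndepFun x P) (hlaw : ∀ i, P.map (x i) = μ) {N : ℕ}
    (hN : 1 ≤ N) (t : ℝ) :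
    P.real {ω | orderStat (fun i => x i ω) N N ≤ t} = cdf μ t ^ N := by
  have hset : {ω | orderStat (fun i => x i ω) N N ≤ t} =
      (fun ω (i : Fin N) => x i ω) ⁻¹' (Set.univ.pi fun _ => Set.Iic t) := by
    ext ω
    simp [orderStat_eq_orderVec, orderVec_self_le_iff hN, -Set.pi_univ_Iic]
  have hvec : Measurable fun ω (i : Fin N) => x i ω := measurable_pi_lambda _ fun i => hx i
  rw [hset, ← map_measureReal_apply hvec
    (MeasurableSet.univ_pi fun _ => measurableSet_Iic),
    map_fin_eq_pi (fun i => (hx i).aemeasurable) hind hlaw, measureReal_def, Measure.pi_pi,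
    cdf_eq_real]
  simp [measureReal_def]

end OrderStatistics

/-! ### The exponential quantile transform -/

section QuantileTransform

/-- The antitone transformation which sends a standard exponential variable to a variable with
law `μ`. -/
noncomputable def expQuantile (μ : Measure ℝ) (v : ℝ) : ℝ :=
  if 0 < v then quantileReal μ (Real.exp (-v)) else 0

variable {μ : Measure ℝ}

lemma expQuantile_of_pos {v : ℝ} (hv : 0 < v) :
    expQuantile μ v = quantileReal μ (Real.exp (-v)) := if_pos hv

lemma exp_neg_lt_one {v : ℝ} (hv : 0 < v) : Real.exp (-v) < 1 :=
  Real.exp_lt_one_iff.2 (neg_lt_zero.2 hv)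

lemma expQuantile_antitoneOn : AntitoneOn (expQuantile μ) (Set.Ioi 0) := by
  intro v hv w hw hvw
  rw [expQuantile_of_pos hv, expQuantile_of_pos hw]
  exact quantileReal_mono (Real.exp_pos _) (Real.exp_le_exp.2 (neg_le_neg hvw))
    (exp_neg_lt_one hv)

lemma measurable_expQuantile : Measurable (expQuantile μ) := by
  refine measurable_of_Iic fun x => ?_
  have hset : expQuantile μ ⁻¹' Set.Iic x =
      (Set.Ioi 0 ∩ {v | Real.exp (-v) ≤ cdf μ x}) ∪ (Set.Iic 0 ∩ {_v | 0 ≤ x}) := by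
    ext v
    rcases lt_or_ge 0 v with hv | hv
    · simp [expQuantile_of_pos hv, quantileReal_le_iff (Real.exp_pos _) (exp_neg_lt_one hv), hv]
    · simp [expQuantile, hv, hv.not_gt]
  rw [hset]
  exact (measurableSet_Ioi.inter (measurableSet_le (by fun_prop) measurable_const)).union
    (measurableSet_Iic.inter (MeasurableSet.const _))

instance noAtoms_expMeasure : NullSingletonClass (expMeasure 1) := by
  rw [expMeasure_eq_withDensity]
  infer_instance

lemma expMeasure_real_Iic {x : ℝ} (hx : 0 ≤ x) :
    (expMeasure 1).real (Set.Iic x) = 1 - Real.exp (-x) := by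
  have := isProbabilityMeasure_expMeasure one_pos
  rw [← cdf_eq_real, cdf_expMeasure_eq one_pos, if_pos hx, one_mul]

lemma ae_expMeasure_pos : ∀ᵐ v ∂expMeasure 1, 0 < v := by
  have := isProbabilityMeasure_expMeasure one_pos
  have h := expMeasure_real_Iic le_rfl
  rw [neg_zero, Real.exp_zero, sub_self, measureReal_eq_zero_iff] at h
  rw [ae_iff]
  simp only [not_lt]
  exact h

/-- Inverse transform sampling, with `exp (-V)` as the uniform variable. -/
lemma map_expQuantile [IsProbabilityMeasure μ] : (expMeasure 1).map (expQuantile μ) = μ := by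
  have := isProbabilityMeasure_expMeasure one_pos
  have := Measure.isProbabilityMeasure_map (μ := expMeasure 1)
    (measurable_expQuantile (μ := μ)).aemeasurable
  refine Measure.eq_of_cdf _ _ (StieltjesFunction.ext fun x => ?_)
  rw [cdf_map_eq_measureReal measurable_expQuantile]
  have hae : {v | expQuantile μ v ≤ x} =ᵐ[expMeasure 1] {v | Real.exp (-v) ≤ cdf μ x} := by
    filter_upwards [ae_expMeasure_pos] with v hv
    refine propext ?_
    change expQuantile μ v ≤ x ↔ Real.exp (-v) ≤ cdf μ x
    rw [expQuantile_of_pos hv, quantileReal_le_iff (Real.exp_pos _) (exp_neg_lt_one hv)]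
  rw [measureReal_congr hae]
  rcases (cdf_nonneg μ x).eq_or_lt with h0 | h0
  · rw [← h0]
    simp [(Real.exp_pos _).not_ge]
  · have hset : {v | Real.exp (-v) ≤ cdf μ x} = (Set.Iio (-Real.log (cdf μ x)))ᶜ := by
      ext v
      rw [Set.mem_compl_iff, Set.mem_Iio, not_lt, Set.mem_ofPred_eq, ← Real.le_log_iff_exp_le h0]
      constructor <;> intro h <;> linarith
    rw [hset, probReal_compl_eq_one_sub measurableSet_Iio, measureReal_congr Iio_ae_eq_Iic,
      expMeasure_real_Iic, neg_neg, Real.exp_log h0, sub_sub_cancel]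
    have := Real.log_nonpos h0.le (cdf_le_one μ x)
    linarith

end QuantileTransform

/-! ### Coupling of the statistic with exponential variables -/

section Coupling

/-- The partial sums which represent the order statistics of `N` exponential variables. -/
noncomputable def renyiSum (e : ℕ → ℝ) (N j : ℕ) : ℝ :=
  ∑ i ∈ Finset.range (j + 1), e i / ((N : ℝ) - i)

lemma renyiMap_eq_renyiSum {N : ℕ} (e : ℕ → ℝ) (j : Fin N) :
    renyiMap N (fun i : Fin N => e i) j = renyiSum e N j := by
  rw [renyiMap_apply, renyiSum]
  refine Finset.sum_bij (fun i _ => (i : ℕ)) ?_ ?_ ?_ ?_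
  · intro i hi
    rw [Finset.mem_Iic, Fin.le_def] at hi
    rw [Finset.mem_range]
    omega
  · intro i _ k _ hik
    exact Fin.ext hik
  · intro k hk
    rw [Finset.mem_range] at hk
    refine ⟨⟨k, by omega⟩, ?_, rfl⟩
    rw [Finset.mem_Iic, Fin.le_def]
    exact Nat.lt_succ_iff.1 hk
  · intro i _
    rfl

variable {Ω Ω₂ : Type*} [MeasurableSpace Ω] [MeasurableSpace Ω₂] {P : Measure Ω}
  {P₂ : Measure Ω₂}

/-- The statistic of interest has the law of its counterpart built from exponential variables. -/
lemma map_evtRatio_eq {x : ℕ → Ω → ℝ} {μ : Measure ℝ} [IsProbabilityMeasure μ]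
    (hx : ∀ i, Measurable (x i)) (hind : iIndepFun x P) (hlaw : ∀ i, P.map (x i) = μ)
    {E : ℕ → Ω₂ → ℝ} (hE : iIndepFun E P₂) (hElaw : ∀ i, HasLaw (E i) (expMeasure 1) P₂)
    (F : ℝ → ℝ) (c : ℝ) {N q r : ℕ} (hq : q < N) (hr : r < N) :
    P.map (fun ω => evtRatio F (fun i => x i ω) N q r c) =
      P₂.map fun ω =>
        (expQuantile μ (renyiSum (fun i => E i ω) N r) - (quantile F (1 - c / N)).toReal) /
          (expQuantile μ (renyiSum (fun i => E i ω) N q) -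
            expQuantile μ (renyiSum (fun i => E i ω) N 0)) := by
  have := isProbabilityMeasure_expMeasure one_pos
  set m := (quantile F (1 - c / N)).toReal with hm
  set ψ : (Fin N → ℝ) → ℝ := fun y =>
    (orderVec y (N - r) - m) / (orderVec y (N - q) - orderVec y N) with hψ
  have hψm : Measurable ψ := ((measurable_orderVec _).sub_const m).div
    ((measurable_orderVec _).sub (measurable_orderVec _))
  set Ψ : (Fin N → ℝ) → ℝ := fun w => (expQuantile μ (w ⟨r, hr⟩) - m) /
    (expQuantile μ (w ⟨q, hq⟩) - expQuantile μ (w ⟨0, by omega⟩)) with hΨ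
  have hex : ∀ i : Fin N, Measurable fun w : Fin N → ℝ => expQuantile μ (w i) := fun i =>
    measurable_expQuantile.comp (measurable_pi_apply i)
  have hΨm : Measurable Ψ := ((hex _).sub_const m).div ((hex _).sub (hex _))
  have hvec : Measurable fun ω (i : Fin N) => x i ω := measurable_pi_lambda _ fun i => hx i
  have hEvec : AEMeasurable (fun ω (i : Fin N) => E i ω) P₂ :=
    aemeasurable_pi_lambda _ fun i => (hElaw i).aemeasurable
  have hcomp : Measurable fun (v : Fin N → ℝ) i => expQuantile μ (v i) :=
    measurable_pi_lambda _ hex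
  have hpi : (Measure.pi fun _ : Fin N => μ) =
      (Measure.pi fun _ : Fin N => expMeasure 1).map fun v i => expQuantile μ (v i) := by
    have : SigmaFinite ((expMeasure 1).map (expQuantile μ)) := by
      rw [map_expQuantile]; infer_instance
    rw [Measure.pi_map_pi fun _ => measurable_expQuantile.aemeasurable, map_expQuantile]
  calc P.map (fun ω => evtRatio F (fun i => x i ω) N q r c)
      = (P.map fun ω (i : Fin N) => x i ω).map ψ := by
        rw [Measure.map_map hψm hvec]
        rfl
    _ = (Measure.pi fun _ : Fin N => expMeasure 1).map fun v => ψ fun i => expQuantile μ (v i) := by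
        rw [map_fin_eq_pi (fun i => (hx i).aemeasurable) hind hlaw, hpi,
          Measure.map_map hψm hcomp]
        rfl
    _ = (Measure.pi fun _ : Fin N => expMeasure 1).map fun v => Ψ (v ∘ Tuple.sort v) := by
        refine Measure.map_congr ?_
        have hpos : ∀ᵐ v ∂(Measure.pi fun _ : Fin N => expMeasure 1), ∀ i, 0 < v i := by
          rw [ae_all_iff]
          exact fun i => (Measure.quasiMeasurePreserving_eval _ i).ae ae_expMeasure_pos
        -- Almost surely all entries are positive, where the transform is antitone: upper rank `N -
        -- j` becomes lower index `j`.
        filter_upwards [hpos] with v hv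
        have h0 := orderVec_comp_antitoneOn (expQuantile_antitoneOn (μ := μ)) hv
          (show 0 < N by omega)
        rw [Nat.sub_zero] at h0
        simp only [hψ, hΨ, h0, orderVec_comp_antitoneOn (expQuantile_antitoneOn (μ := μ)) hv hr,
          orderVec_comp_antitoneOn (expQuantile_antitoneOn (μ := μ)) hv hq]
    _ = ((P₂.map fun ω (i : Fin N) => E i ω).map (renyiMap N)).map Ψ := by
        rw [map_fin_eq_pi (fun i => (hElaw i).aemeasurable) hE fun i => (hElaw i).map_eq,
          ← map_comp_sort_pi_expMeasure, Measure.map_map hΨm (measurable_comp_sort N)]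
        rfl
    _ = _ := by
        rw [Measure.map_map hΨm (measurable_renyiMap N),
          AEMeasurable.map_map_of_aemeasurable
            (hΨm.comp (measurable_renyiMap N)).aemeasurable hEvec]
        congr 1
        ext ω
        simp only [Function.comp_apply, hΨ]
        rw [renyiMap_eq_renyiSum (fun i => E i ω), renyiMap_eq_renyiSum (fun i => E i ω),
          renyiMap_eq_renyiSum (fun i => E i ω)]

variable [IsProbabilityMeasure P] [IsProbabilityMeasure P₂]

/-- Convergence in law sees only the laws, so a coupled copy on another space may be used; equality
is only required eventually, once `N > q, r`. -/
lemma tendstoInDistribution_of_eventually_map_eq {ι : Type*} {l : Filter ι} {X : ι → Ω → ℝ}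
    {Y : ι → Ω₂ → ℝ} {Z : Ω₂ → ℝ} (hX : ∀ i, AEMeasurable (X i) P)
    (hY : TendstoInDistribution Y l Z (fun _ => P₂) P₂)
    (heq : ∀ᶠ i in l, P.map (X i) = P₂.map (Y i)) :
    TendstoInDistribution X l Z (fun _ => P) P₂ where
  forall_aemeasurable := hX
  aemeasurable_limit := hY.aemeasurable_limit
  tendsto := hY.tendsto.congr' (heq.mono fun _ hi => Subtype.ext hi.symm)

end Coupling

/-! ### Pointwise convergence of the coupled statistic -/

section Pointwise

lemma tendsto_natCast_mul_renyiSum (e : ℕ → ℝ) (j : ℕ) :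
    Tendsto (fun N : ℕ => (N : ℝ) * renyiSum e N j) atTop
      (𝓝 (∑ i ∈ Finset.range (j + 1), e i)) := by
  simp only [renyiSum, Finset.mul_sum]
  refine tendsto_finsetSum _ fun i _ => ?_
  have h1 : Tendsto (fun N : ℕ => (1 - (i : ℝ) / N)⁻¹) atTop (𝓝 1) := by
    have h2 := (tendsto_const_nhds (x := (1 : ℝ))).sub (tendsto_const_div_atTop_nhds_zero_nat (i : ℝ))
    rw [sub_zero] at h2
    simpa using h2.inv₀ one_ne_zero
  have h3 := h1.const_mul (e i)
  rw [mul_one] at h3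
  refine h3.congr' ?_
  filter_upwards [eventually_gt_atTop i] with N hN
  have hN0 : (N : ℝ) ≠ 0 := by
    have : 0 < N := by omega
    positivity
  have hNi : (N : ℝ) - i ≠ 0 := by
    have : (i : ℝ) < N := by exact_mod_cast hN
    linarith
  field_simp

lemma renyiSum_pos {e : ℕ → ℝ} (he : ∀ i, 0 < e i) {N j : ℕ} (hj : j < N) :
    0 < renyiSum e N j := by
  refine Finset.sum_pos (fun i hi => div_pos (he i) ?_) ⟨0, by simp⟩
  have : (i : ℝ) < N := by
    have := Finset.mem_range.1 hi
    exact_mod_cast (by omega : i < N)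
  linarith

/-- The error `|1 - exp (-w) - w|` is at most `w ^ 2`, and `N * w ^ 2 = (N * w) * w → 0`. -/
lemma tendsto_natCast_mul_one_sub_exp_neg {w : ℕ → ℝ} {s : ℝ}
    (hw : Tendsto (fun N : ℕ => (N : ℝ) * w N) atTop (𝓝 s)) :
    Tendsto (fun N : ℕ => (N : ℝ) * (1 - Real.exp (-w N))) atTop (𝓝 s) := by
  have hw0 : Tendsto w atTop (𝓝 0) := by
    have h := hw.mul tendsto_inv_atTop_nhds_zero_nat
    rw [mul_zero] at h
    refine h.congr' ?_
    filter_upwards [eventually_gt_atTop 0] with N hN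
    field_simp
  have hsq : Tendsto (fun N : ℕ => (N : ℝ) * w N * w N) atTop (𝓝 0) := by
    simpa using hw.mul hw0
  have hdiff : Tendsto (fun N : ℕ => (N : ℝ) * (1 - Real.exp (-w N)) - N * w N) atTop (𝓝 0) := by
    refine squeeze_zero_norm' ?_ hsq
    have hev : ∀ᶠ N in atTop, |w N| ≤ 1 := by
      have h := hw0.abs
      rw [abs_zero] at h
      exact (h.eventually (gt_mem_nhds one_pos)).mono fun _ h => h.le
    filter_upwards [hev] with N hN
    have h1 := Real.abs_exp_sub_one_sub_id_le (x := -w N) (by rwa [abs_neg])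
    rw [Real.norm_eq_abs, ← mul_sub, abs_mul, Nat.abs_cast, mul_assoc]
    refine mul_le_mul_of_nonneg_left ?_ (Nat.cast_nonneg N)
    rw [abs_sub_comm] at h1
    have h2 : 1 - Real.exp (-w N) - w N = -w N - (Real.exp (-w N) - 1) := by ring
    rw [h2]
    linarith [sq (w N), neg_sq (w N)]
  simpa using hdiff.add hw

variable {Ω : Type*} [MeasurableSpace Ω] {P : Measure Ω} [IsProbabilityMeasure P]
  {θ₀ : Ω → ℝ} {ε₀ : ℕ → Ω → ℝ} {p γ : ℝ} {a α β : ℕ → ℝ} {l : Filter (ℕ × ℕ)}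

/-- Under tail equivalence, upper intermediate quantiles of the noisy observations, normalised as
those of the latent variable, have the same limit. -/
lemma tendsto_expQuantile_noisy (hθ : Measurable θ₀) (hε : ∀ T, Measurable (ε₀ T))
    (hα : ∀ N, 0 < α N)
    (hgev : ∀ x : ℝ, Tendsto (fun N : ℕ => cdf (P.map θ₀) (α N * x + β N) ^ N) atTop
      (𝓝 (gevCDF γ x)))
    (ha : ∀ N, 0 < a N) {C : ℝ} (hC : 0 < C) (haα : ∀ᶠ N in atTop, a N ≤ C * α N)
    (hl : l ≤ atTop ×ˢ atTop)
    (hsup : TailEquivSup (cdf (P.map θ₀)) (fun T => cdf (P.map (ε₀ T))) p a l)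
    (hinf : TailEquivInf (cdf (P.map θ₀)) (fun T => cdf (P.map (ε₀ T))) p a l)
    {w : ℕ → ℝ} {s : ℝ} (hs : 0 < s) (hwpos : ∀ᶠ N in atTop, 0 < w N)
    (hw : Tendsto (fun N : ℕ => (N : ℝ) * w N) atTop (𝓝 s)) :
    Tendsto (fun k : ℕ × ℕ =>
      (expQuantile (P.map fun ω => θ₀ ω + 1 / (k.2 : ℝ) ^ p * ε₀ k.2 ω) (w k.1) - β k.1) / α k.1)
      l (𝓝 (gevQuantile γ s)) := by
  have hfst : Tendsto (fun k : ℕ × ℕ => k.1) l atTop := tendsto_fst.mono_left hl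
  have hexp := tendsto_natCast_mul_one_sub_exp_neg hw
  have hcont : ContinuousAt (gevQuantile γ) s :=
    (continuousOn_gevQuantile γ).continuousAt (Ioi_mem_nhds hs)
  -- The tail conditions at `τ = 1/t` concern the level `1 - t/N`.
  have hlevel : ∀ (t : ℝ) (N : ℕ), 1 - 1 / ((N : ℝ) * (1 / t)) = 1 - t / N := fun t N => by
    rw [mul_one_div, one_div_div]
  refine tendsto_order.2 ⟨fun x hx => ?_, fun x hx => ?_⟩
  -- For `t` slightly above `s`, the level `exp (-w N)` eventually exceeds `1 - t/N`, while the
  -- limit at `t` still exceeds `x`.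
  · obtain ⟨t, htx, hst⟩ := (((hcont.tendsto.eventually (lt_mem_nhds hx)).filter_mono
      nhdsWithin_le_nhds).and (self_mem_nhdsWithin (s := Set.Ioi s))).exists
    have hst : s < t := hst
    have ht : 0 < t := hs.trans hst
    -- Since `a ≤ C α`, the tail error uses half of the gap; the other half absorbs the convergence
    -- of the quantiles of `θ₀`.
    have hδ : 0 < (gevQuantile γ t - x) / (2 * C) := div_pos (sub_pos.2 htx) (by positivity)
    have hq := (tendsto_quantileReal_div hα hgev ht).eventually
      (lt_mem_nhds (show (x + gevQuantile γ t) / 2 < gevQuantile γ t by linarith))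
    filter_upwards [hsup.eventually_quantileReal_sub_le hθ hε ha hl (one_div_pos.2 ht) hδ,
      hfst.eventually hq, hfst.eventually haα, hfst.eventually hwpos,
      hfst.eventually (eventually_one_sub_div_mem ht),
      hfst.eventually (hexp.eventually (gt_mem_nhds hst))] with k h1 h2 h3 h4 h5 h6
    obtain ⟨hN, hlev0, hlev1⟩ := h5
    rw [hlevel] at h1
    rw [lt_div_iff₀ (hα _)] at h2 ⊢
    rw [expQuantile_of_pos h4]
    have hu : 1 - t / k.1 ≤ Real.exp (-w k.1) := by
      rw [mul_comm, ← lt_div_iff₀ hN] at h6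
      linarith
    have h7 := quantileReal_mono
      (μ := P.map fun ω => θ₀ ω + 1 / (k.2 : ℝ) ^ p * ε₀ k.2 ω) hlev0 hu (exp_neg_lt_one h4)
    have h8 : (gevQuantile γ t - x) / (2 * C) * a k.1 ≤ (gevQuantile γ t - x) / 2 * α k.1 := by
      refine (mul_le_mul_of_nonneg_left h3 hδ.le).trans_eq ?_
      field_simp
    linarith
  · have hev : ∀ᶠ t in 𝓝[<] s, gevQuantile γ t < x ∧ 0 < t :=
      ((hcont.tendsto.eventually (gt_mem_nhds hx)).and (lt_mem_nhds hs)).filter_mono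
        nhdsWithin_le_nhds
    obtain ⟨t, ⟨htx, ht⟩, hst⟩ := (hev.and (self_mem_nhdsWithin (s := Set.Iio s))).exists
    have hst : t < s := hst
    have hδ : 0 < (x - gevQuantile γ t) / (2 * C) := div_pos (sub_pos.2 htx) (by positivity)
    have hq := (tendsto_quantileReal_div hα hgev ht).eventually
      (gt_mem_nhds (show gevQuantile γ t < (x + gevQuantile γ t) / 2 by linarith))
    filter_upwards [hinf.eventually_quantileReal_le_add hθ hε ha hl (one_div_pos.2 ht) hδ,
      hfst.eventually hq, hfst.eventually haα, hfst.eventually hwpos,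
      hfst.eventually (eventually_one_sub_div_mem ht),
      hfst.eventually (hexp.eventually (lt_mem_nhds hst))] with k h1 h2 h3 h4 h5 h6
    obtain ⟨hN, hlev0, hlev1⟩ := h5
    rw [hlevel] at h1
    rw [div_lt_iff₀ (hα _)] at h2 ⊢
    rw [expQuantile_of_pos h4]
    have hu : Real.exp (-w k.1) ≤ 1 - t / k.1 := by
      rw [mul_comm, ← div_lt_iff₀ hN] at h6
      linarith
    have h7 := quantileReal_mono
      (μ := P.map fun ω => θ₀ ω + 1 / (k.2 : ℝ) ^ p * ε₀ k.2 ω) (Real.exp_pos _) hu hlev1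
    have h8 : (x - gevQuantile γ t) / (2 * C) * a k.1 ≤ (x - gevQuantile γ t) / 2 * α k.1 := by
      refine (mul_le_mul_of_nonneg_left h3 hδ.le).trans_eq ?_
      field_simp
    linarith

/-- `gevQuantile γ` is affine in `t ^ (-γ)`, or in `log t` when `γ = 0`, and the ratio of
differences is invariant under affine maps. -/
lemma evtLimit_eq_gevQuantile (γ : ℝ) (e : ℕ → ℝ) (q r : ℕ) (c : ℝ) :
    evtLimit γ e q r c =
      (gevQuantile γ (∑ i ∈ Finset.range (r + 1), e i) - gevQuantile γ c) /
        (gevQuantile γ (∑ i ∈ Finset.range (q + 1), e i) - gevQuantile γ (e 0)) := by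
  unfold evtLimit gevQuantile
  split_ifs with h
  · rw [neg_sub_neg, neg_sub_neg, ← neg_sub, ← neg_sub (Real.log (e 0)), neg_div_neg_eq,
      ← neg_div_neg_eq, neg_sub, neg_sub]
  · rw [← sub_div, ← sub_div, sub_sub_sub_cancel_right, sub_sub_sub_cancel_right,
      div_div_div_cancel_right₀ h]

end Pointwise

/-! ### ### Convergence in law through the coupling -/

section Limit

variable {Ω Ω₂ : Type*} [MeasurableSpace Ω] [MeasurableSpace Ω₂] {P : Measure Ω}
  [IsProbabilityMeasure P] {P₂ : Measure Ω₂} [IsProbabilityMeasure P₂]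

/-- The self-normalised statistic converges in distribution as soon as the normalised centring
constants converge. -/
lemma tendstoInDistribution_evtRatio {p : ℝ} {θ : ℕ → Ω → ℝ} {ε : ℕ → ℕ → Ω → ℝ}
    (hθ : ∀ i, Measurable (θ i)) (hε : ∀ i T, Measurable (ε i T))
    (hindep : ∀ T, iIndepFun (fun (i : ℕ) (ω : Ω) => (θ i ω, ε i T ω)) P)
    (hident : ∀ T i, IdentDistrib (fun ω => (θ i ω, ε i T ω)) (fun ω => (θ 0 ω, ε 0 T ω)) P P)
    {γ : ℝ} {a α β : ℕ → ℝ} (hα : ∀ N, 0 < α N)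
    (hgev : ∀ x : ℝ, Tendsto (fun N : ℕ => cdf (P.map (θ 0)) (α N * x + β N) ^ N) atTop
      (𝓝 (gevCDF γ x)))
    (ha : ∀ N, 0 < a N) {C : ℝ} (hC : 0 < C) (haα : ∀ᶠ N in atTop, a N ≤ C * α N)
    {l : Filter (ℕ × ℕ)} [l.IsCountablyGenerated] (hl : l ≤ atTop ×ˢ atTop)
    (hsup : TailEquivSup (cdf (P.map (θ 0))) (fun T => cdf (P.map (ε 0 T))) p a l)
    (hinf : TailEquivInf (cdf (P.map (θ 0))) (fun T => cdf (P.map (ε 0 T))) p a l)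
    {E : ℕ → Ω₂ → ℝ} (hE : iIndepFun E P₂) (hElaw : ∀ i, HasLaw (E i) (expMeasure 1) P₂)
    {q r : ℕ} (hq : 1 ≤ q) {c : ℝ}
    (hc : Tendsto (fun N : ℕ => (quantileReal (P.map (θ 0)) (1 - c / N) - β N) / α N) atTop
      (𝓝 (gevQuantile γ c))) :
    TendstoInDistribution
      (fun (s : ℕ × ℕ) (ω : Ω) =>
        evtRatio (cdf (P.map (θ 0))) (fun i => noisyObs p θ ε s.2 i ω) s.1 q r c)
      l (fun ω => evtLimit γ (fun i => E i ω) q r c) (fun _ => P) P₂ := by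
  have hfst : Tendsto (fun k : ℕ × ℕ => k.1) l atTop := tendsto_fst.mono_left hl
  set μ : ℕ → Measure ℝ := fun T => P.map fun ω => θ 0 ω + 1 / (T : ℝ) ^ p * ε 0 T ω with hμ
  have hpair : ∀ T : ℕ, Measurable fun z : ℝ × ℝ => z.1 + 1 / (T : ℝ) ^ p * z.2 := fun T => by
    fun_prop
  have hobs : ∀ T i, Measurable (noisyObs p θ ε T i) := fun T i =>
    (hθ i).add ((hε i T).const_mul _)
  have hμprob : ∀ T, IsProbabilityMeasure (μ T) := fun T =>
    Measure.isProbabilityMeasure_map (hobs T 0).aemeasurable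
  have hobs_indep : ∀ T, iIndepFun (fun i => noisyObs p θ ε T i) P := fun T =>
    (hindep T).comp (fun _ z => z.1 + 1 / (T : ℝ) ^ p * z.2) fun _ => hpair T
  have hobs_law : ∀ T i, P.map (noisyObs p θ ε T i) = μ T := fun T i =>
    ((hident T i).comp (hpair T)).map_eq
  have hS : ∀ j, AEMeasurable (fun ω => ∑ i ∈ Finset.range (j + 1), E i ω) P₂ := fun j =>
    Finset.aemeasurable_fun_sum _ fun i _ => (hElaw i).aemeasurable
  have hgq : Measurable (gevQuantile γ) := by
    unfold gevQuantile
    split_ifs <;> fun_prop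
  refine tendstoInDistribution_of_eventually_map_eq (fun s => ?_)
    (tendstoInDistribution_of_ae_tendsto (X := fun (s : ℕ × ℕ) ω =>
      (expQuantile (μ s.2) (renyiSum (fun i => E i ω) s.1 r) -
          quantileReal (P.map (θ 0)) (1 - c / s.1)) /
        (expQuantile (μ s.2) (renyiSum (fun i => E i ω) s.1 q) -
          expQuantile (μ s.2) (renyiSum (fun i => E i ω) s.1 0))) (fun s => ?_) ?_ ?_) ?_
  · have hvec : Measurable fun ω (i : Fin s.1) => noisyObs p θ ε s.2 i ω :=
      measurable_pi_lambda _ fun i => hobs s.2 i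
    have hord : ∀ k, Measurable fun ω => orderStat (fun i => noisyObs p θ ε s.2 i ω) k s.1 :=
      fun k => (measurable_orderVec k).comp hvec
    exact (((hord _).sub_const _).div ((hord _).sub (hord _))).aemeasurable
  · have hw : ∀ j, AEMeasurable
        (fun ω => expQuantile (μ s.2) (renyiSum (fun i => E i ω) s.1 j)) P₂ := fun j =>
      measurable_expQuantile.comp_aemeasurable
        (Finset.aemeasurable_fun_sum _ fun i _ => (hElaw i).aemeasurable.div_const _)
    exact ((hw r).sub_const _).div ((hw q).sub (hw 0))
  · simp only [evtLimit_eq_gevQuantile]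
    exact ((hgq.comp_aemeasurable (hS r)).sub_const _).div ((hgq.comp_aemeasurable (hS q)).sub
      (hgq.comp_aemeasurable (hElaw 0).aemeasurable))
  · have hpos : ∀ᵐ ω ∂P₂, ∀ i, 0 < E i ω := by
      rw [ae_all_iff]
      intro i
      have h := ae_expMeasure_pos
      rw [← (hElaw i).map_eq] at h
      exact ae_of_ae_map (hElaw i).aemeasurable h
    filter_upwards [hpos] with ω hω
    have hSpos : ∀ j, 0 < ∑ i ∈ Finset.range (j + 1), E i ω := fun j =>
      Finset.sum_pos (fun i _ => hω i) ⟨0, by simp⟩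
    have hlim : ∀ j, Tendsto (fun k : ℕ × ℕ =>
        (expQuantile (μ k.2) (renyiSum (fun i => E i ω) k.1 j) - β k.1) / α k.1) l
        (𝓝 (gevQuantile γ (∑ i ∈ Finset.range (j + 1), E i ω))) := fun j =>
      tendsto_expQuantile_noisy (hθ 0) (hε 0) hα hgev ha hC haα hl hsup hinf
        (w := fun N => renyiSum (fun i => E i ω) N j) (hSpos j)
        ((eventually_gt_atTop j).mono fun N hN => renyiSum_pos (e := fun i => E i ω) hω hN)
        (tendsto_natCast_mul_renyiSum (fun i => E i ω) j)
    -- As `q ≥ 1`, the larger sum contains the extra positive term `E 1 ω`, so the limiting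
    -- denominator is nonzero.
    have hlt : ∑ i ∈ Finset.range (0 + 1), E i ω < ∑ i ∈ Finset.range (q + 1), E i ω :=
      Finset.sum_lt_sum_of_subset (i := 1) (Finset.range_subset_range.2 (by omega))
        (Finset.mem_range.2 (by omega)) (by simp) (hω 1) fun i _ _ => (hω i).le
    have hne : gevQuantile γ (∑ i ∈ Finset.range (q + 1), E i ω) -
        gevQuantile γ (∑ i ∈ Finset.range (0 + 1), E i ω) ≠ 0 :=
      (sub_neg.2 (gevQuantile_strictAntiOn γ (hSpos 0) (hSpos q) hlt)).ne
    have hdiv := ((hlim r).sub (hc.comp hfst)).div ((hlim q).sub (hlim 0)) hne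
    rw [evtLimit_eq_gevQuantile]
    rw [zero_add, Finset.sum_range_one] at hdiv
    refine hdiv.congr fun k => ?_
    simp only [Pi.div_apply, Function.comp_apply]
    rw [← sub_div, ← sub_div, sub_sub_sub_cancel_right, sub_sub_sub_cancel_right,
      div_div_div_cancel_right₀ (hα _).ne']
  · filter_upwards [hfst.eventually (eventually_gt_atTop q), hfst.eventually (eventually_gt_atTop r)]
      with s hqs hrs
    exact map_evtRatio_eq (hobs s.2) (hobs_indep s.2) (hobs_law s.2) hE hElaw _ c hqs hrs

end Limit

theorem theorem3
    {Ω Ω₁ Ω₂ : Type*} [MeasurableSpace Ω] [MeasurableSpace Ω₁] [MeasurableSpace Ω₂]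
    -- latent heterogeneity `θ i`, noise `ε i T`, rate `p`
    (P : Measure Ω) [IsProbabilityMeasure P]
    (p : ℝ) (hp : 0 < p)
    (θ : ℕ → Ω → ℝ) (ε : ℕ → ℕ → Ω → ℝ)
    (hθ : ∀ i, Measurable (θ i)) (hε : ∀ i T, Measurable (ε i T))
    -- for each `T` the vectors `(θ i, ε i T)` are iid over `i`
    (hindep : ∀ T, iIndepFun (fun (i : ℕ) (ω : Ω) => (θ i ω, ε i T ω)) P)
    (hident : ∀ T i, IdentDistrib (fun ω => (θ i ω, ε i T ω)) (fun ω => (θ 0 ω, ε 0 T ω)) P P)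
    -- the marginal distribution functions
    (F : ℝ → ℝ) (hF : ∀ x, F x = cdf (P.map (θ 0)) x)
    (G : ℕ → ℝ → ℝ) (hG : ∀ T x, G T x = cdf (P.map (ε 0 T)) x)
    -- `F` has extreme value index `γ`
    (γ : ℝ) (hγ : InDomainOfAttraction F γ)
    -- the normalised noiseless maximum converges weakly to a nondegenerate `X`
    (a b : ℕ → ℝ) (ha : ∀ N, 0 < a N)
    (P₁ : Measure Ω₁) [IsProbabilityMeasure P₁] (X : Ω₁ → ℝ)
    (hX : ∀ c : ℝ, ¬ ∀ᵐ ω ∂P₁, X ω = c)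
    (hmax : TendstoInDistribution
      (fun (N : ℕ) (ω : Ω) => (orderStat (fun i => θ i ω) N N - b N) / a N)
      atTop X (fun _ => P) P₁)
    -- the way in which `N, T → ∞`, along which the tail equivalence conditions hold
    (l : Filter (ℕ × ℕ)) [l.IsCountablyGenerated] (hl : l ≤ atTop ×ˢ atTop)
    (hsup : TailEquivSup F G p a l) (hinf : TailEquivInf F G p a l)
    -- iid standard exponentials
    (P₂ : Measure Ω₂) [IsProbabilityMeasure P₂] (E : ℕ → Ω₂ → ℝ)
    (hE : iIndepFun E P₂) (hElaw : ∀ i, HasLaw (E i) (expMeasure 1) P₂)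
    (q r : ℕ) (hq : 1 ≤ q) :
    (∀ c : ℝ, 0 < c → TendstoInDistribution
      (fun (s : ℕ × ℕ) (ω : Ω) => evtRatio F (fun i => noisyObs p θ ε s.2 i ω) s.1 q r c)
      l (fun ω => evtLimit γ (fun i => E i ω) q r c) (fun _ => P) P₂) ∧
    (γ < 0 → quantile F 1 < ⊤ ∧ TendstoInDistribution
      (fun (s : ℕ × ℕ) (ω : Ω) => evtRatio F (fun i => noisyObs p θ ε s.2 i ω) s.1 q r 0)
      l (fun ω => evtLimit γ (fun i => E i ω) q r 0) (fun _ => P) P₂) := by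
  obtain rfl : F = cdf (P.map (θ 0)) := funext hF
  obtain rfl : G = fun T => (cdf (P.map (ε 0 T)) : ℝ → ℝ) := funext fun T => funext (hG T)
  obtain ⟨α, β, hα, hgev⟩ := hγ
  have := Measure.isProbabilityMeasure_map (μ := P) (hθ 0).aemeasurable
  have hθindep : iIndepFun θ P := (hindep 0).comp (fun _ z => z.1) fun _ => measurable_fst
  have hθlaw : ∀ i, P.map (θ i) = P.map (θ 0) := fun i =>
    ((hident 0 i).comp measurable_fst).map_eq
  have hmaxm : ∀ N, Measurable fun ω => orderStat (fun i => θ i ω) N N := fun N =>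
    (measurable_orderVec N).comp (measurable_pi_lambda _ fun i : Fin N => hθ i)
  -- The attraction hypothesis, read as convergence of the law of the noiseless maximum, so that `α`
  -- can be compared with `a`.
  have hM : ∀ x : ℝ, Tendsto (fun N : ℕ =>
      P.real {ω | orderStat (fun i => θ i ω) N N ≤ α N * x + β N}) atTop (𝓝 (gevCDF γ x)) := by
    intro x
    refine (hgev x).congr' ?_
    filter_upwards [eventually_ge_atTop 1] with N hN
    exact (measureReal_orderStat_self_le hθ hθindep hθlaw hN _).symm
  obtain ⟨C, hC, haα⟩ := exists_eventually_le_mul hα ha hmaxm hM hX hmax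
  refine ⟨fun c hc => ?_, fun hγ => ⟨quantile_one_lt_top hα hgev hγ, ?_⟩⟩
  · exact tendstoInDistribution_evtRatio hθ hε hindep hident hα hgev ha hC haα hl hsup hinf hE
      hElaw hq (tendsto_quantileReal_div hα hgev hc)
  · refine tendstoInDistribution_evtRatio hθ hε hindep hident hα hgev ha hC haα hl hsup hinf hE
      hElaw hq ?_
    simp only [zero_div, sub_zero]
    exact tendsto_quantileReal_one_div hα hgev hγ
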